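/- **Setting.** Let $\Lambda\in\mathbf M_2(\mathbb R)$ be symmetric positive definite, $H\in\mathbf{GL}_2(\mathbb R)$ symmetric, $K_1\in C^0([0,1];\mathbf M_2(\mathbb R))$ with $K_1(\xi)$ symmetric and invertible for all $\xi\in[0,1]$, $K_2,K_3\in C^0([0,1];\mathbf M_2(\mathbb R))$, $K_4\in\mathbf M_2(\mathbb R)$, $\Sigma\in C^0(\mathbb R^2;\mathbf M_2(\mathbb R))$ and $\theta\ge 0$. Assume that $\mathscr Q(\xi)=K_1(\xi)H^{-1}$ is symmetric and positive definite for every $\xi\in[0,1]$, and write $(\mathscr Q\zeta)(\xi)=\mathscr Q(\xi)\zeta(\xi)$. (In the single-track vehicle model all these matrices are diagonal and the diagonal entries of $\Lambda$, $H$, $K_1(\xi)$ are positive.) Put $$\mathscr K_2\zeta=\int_0^1K_2(\xi)\zeta(\xi)\,d\xi,\qquad \mathscr K_3\zeta=\int_0^1K_3(\xi)\zeta(\xi)\,d\xi+K_4\zeta(1).$$ On the real Hilbert space $L^2((0,1);\mathbb R^2)$, with inner product $\langle f,g\rangle=\int_0^1 f(\xi)^{\mathrm T}g(\xi)\,d\xi$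 and norm $\|\cdot\|$, consider the unbounded operators $$\mathscr A\zeta=-\Lambda\,\frac{\partial\zeta}{\partial\xi}+\mathscr K_3\zeta,\qquad \mathscr A_\Sigma(y)\zeta=\theta\,\Sigma(y)\,[\zeta+\mathscr K_2\zeta]+\mathscr A\zeta\quad(y\in\mathbb R^2),$$ both with domain $\mathscr D(\mathscr A)=\mathscr D(\mathscr A_\Sigma(y))=\{\zeta\in H^1((0,1);\mathbb R^2):\zeta(0)=0\}$, where $\mathscr K_2\zeta,\mathscr K_3\zeta\in\mathbb R^2$ are regarded as constant functions. **Proposition (strict dissipativity).** Assume: 1. there is $\omega>0$ such that $\langle\mathscr A\zeta,\mathscr Q\zeta\rangle\le-\omega\|\zeta\|^2$ for all $\zeta\in\mathscr D(\mathscr A)$; 2. $\int_0^1\zeta(\xi)^{\mathrm T}\mathscr Q(\xi)\Sigma(y)[\zeta(\xi)+\mathscr K_2\zeta]\,d\xi\le0$ for all $y\in\mathbb R^2$ and $\zeta\in L^2((0,1);\mathbb R^2)$, and there is $L_\Sigma\ge0$ with $\|\Sigma(y_1)-\Sigma(y_2)\|\le L_\Sigma\|y_1-y_2\|_2$ for all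 $y_1,y_2\in\mathbb R^2$. Then, for every $y\in\mathbb R^2$, the operator $\mathscr A_\Sigma(y)$ with the above domain generates an exponentially stable $C_0$-semigroup on $L^2((0,1);\mathbb R^2)$, i.e. it is the infinitesimal generator of a $C_0$-semigroup $(T(t))_{t\ge0}$ for which there are $M\in\mathbb R$ and $\alpha>0$ with $\|T(t)\|\le Me^{-\alpha t}$ for all $t\ge0$. Moreover, $$\langle\mathscr A_\Sigma(y)\zeta,\mathscr Q\zeta\rangle\le-\omega\|\zeta\|^2\qquad\text{for all }\zeta\in\mathscr D(\mathscr A_\Sigma(y)),$$ with the same $\omega$ as in assumption 1. -/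

import Mathlib

noncomputable section

open MeasureTheory Set Filter Topology
open scoped NNReal ENNReal

/-! ### Strongly continuous semigroups -/

/-- A strongly continuous (`C₀`) semigroup of bounded linear operators on a normed space `X`. -/
structure C0Semigroup (X : Type*) [NormedAddCommGroup X] [NormedSpace ℝ X] where
  toFun : ℝ≥0 → X →L[ℝ] X
  map_zero : toFun 0 = ContinuousLinearMap.id ℝ X
  map_add : ∀ s t, toFun (s + t) = (toFun s).comp (toFun t)
  continuous_orbit : ∀ x, Continuous fun t => toFun t x

namespace C0Semigroup

variable {X : Type*} [NormedAddCommGroup X] [NormedSpace ℝ X]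

/-- The (unbounded) operator `A` is the infinitesimal generator of `T`: a vector `x` lies in the
domain of `A` and `A x = y` if and only if `(T h x - x) / h → y` as `h → 0⁺`. -/
def IsGeneratedBy (T : C0Semigroup X) (A : X →ₗ.[ℝ] X) : Prop :=
  ∀ x y : X, (x, y) ∈ A.graph ↔
    Tendsto (fun h : ℝ≥0 => (h : ℝ)⁻¹ • (T.toFun h x - x)) (𝓝[>] 0) (𝓝 y)

/-- Exponential stability: `‖T t‖ ≤ M e^{-α t}` for some `M`, some `α > 0` and all `t ≥ 0`. -/
def IsExponentiallyStable (T : C0Semigroup X) : Prop :=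
  ∃ M α : ℝ, 0 < α ∧ ∀ t : ℝ≥0, ‖T.toFun t‖ ≤ M * Real.exp (-α * t)

end C0Semigroup

namespace TireFriction

/-- `ℝ²` with its Euclidean norm. -/
abbrev R2 := EuclideanSpace ℝ (Fin 2)

/-- Real `2 × 2` matrices. -/
abbrev M2 := Matrix (Fin 2) (Fin 2) ℝ

/-- The matrix `M` as a bounded operator on `ℝ²`, `v ↦ M v`. -/
abbrev act (M : M2) : R2 →L[ℝ] R2 := Matrix.toEuclideanCLM (n := Fin 2) (𝕜 := ℝ) M

/-- Lebesgue measure on the interval `(0,1)`. -/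
abbrev vol01 : Measure ℝ := volume.restrict (Ioo (0 : ℝ) 1)

/-- The Hilbert space `L²((0,1);ℝ²)`. -/
abbrev L2 : Type := Lp R2 2 vol01

/-! ### Weak derivatives and the space `H¹((0,1);ℝ²)` -/

/-- `g` is the weak derivative of `ζ` on `(0,1)`. -/
def IsWeakDeriv (ζ g : L2) : Prop :=
  ∀ φ : ℝ → ℝ, ContDiff ℝ (⊤ : ℕ∞) φ → HasCompactSupport φ → tsupport φ ⊆ Ioo 0 1 →
    ∫ ξ in Ioo (0 : ℝ) 1, deriv φ ξ • ζ ξ = -∫ ξ in Ioo (0 : ℝ) 1, φ ξ • g ξ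

/-- `w` is a representative of the class `ζ` that is continuous up to the boundary of `(0,1)`;
the boundary values of `ζ` are then `w 0` and `w 1`. -/
def IsContRep (ζ : L2) (w : ℝ → R2) : Prop :=
  ContinuousOn w (Icc 0 1) ∧ ζ =ᵐ[vol01] w

lemma integrable_L2 (ζ : L2) : Integrable ζ vol01 :=
  (Lp.memLp ζ).integrable (by norm_num)

lemma integrable_smul_of_continuous {φ : ℝ → ℝ} (hφ : Continuous φ) (hc : HasCompactSupport φ)
    (ζ : L2) : Integrable (fun ξ => φ ξ • ζ ξ) vol01 := by
  obtain ⟨C, hC⟩ := hc.exists_bound_of_continuous hφ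
  exact (integrable_L2 ζ).bdd_smul C hφ.aestronglyMeasurable (ae_of_all _ hC)

lemma IsWeakDeriv.add {ζ ζ' g g' : L2} (h : IsWeakDeriv ζ g) (h' : IsWeakDeriv ζ' g') :
    IsWeakDeriv (ζ + ζ') (g + g') := by
  intro φ hφ hc hs
  have hd : Continuous (deriv φ) := hφ.continuous_deriv (by simp)
  have e1 : ∫ ξ in Ioo (0 : ℝ) 1, deriv φ ξ • (ζ + ζ' : L2) ξ
      = ∫ ξ in Ioo (0 : ℝ) 1, (deriv φ ξ • ζ ξ + deriv φ ξ • ζ' ξ) := by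
    refine integral_congr_ae ?_
    filter_upwards [Lp.coeFn_add ζ ζ'] with ξ hξ
    rw [hξ, Pi.add_apply, smul_add]
  have e2 : ∫ ξ in Ioo (0 : ℝ) 1, φ ξ • (g + g' : L2) ξ
      = ∫ ξ in Ioo (0 : ℝ) 1, (φ ξ • g ξ + φ ξ • g' ξ) := by
    refine integral_congr_ae ?_
    filter_upwards [Lp.coeFn_add g g'] with ξ hξ
    rw [hξ, Pi.add_apply, smul_add]
  rw [e1, e2, integral_add (integrable_smul_of_continuous hd hc.deriv ζ)
    (integrable_smul_of_continuous hd hc.deriv ζ'),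
    integral_add (integrable_smul_of_continuous hφ.continuous hc g)
    (integrable_smul_of_continuous hφ.continuous hc g'), h φ hφ hc hs, h' φ hφ hc hs, neg_add]

lemma IsWeakDeriv.smul {ζ g : L2} (c : ℝ) (h : IsWeakDeriv ζ g) :
    IsWeakDeriv (c • ζ) (c • g) := by
  intro φ hφ hc hs
  have e1 : ∫ ξ in Ioo (0 : ℝ) 1, deriv φ ξ • (c • ζ : L2) ξ
      = ∫ ξ in Ioo (0 : ℝ) 1, c • (deriv φ ξ • ζ ξ) := by
    refine integral_congr_ae ?_
    filter_upwards [Lp.coeFn_smul c ζ] with ξ hξ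
    rw [hξ, Pi.smul_apply, smul_comm]
  have e2 : ∫ ξ in Ioo (0 : ℝ) 1, φ ξ • (c • g : L2) ξ
      = ∫ ξ in Ioo (0 : ℝ) 1, c • (φ ξ • g ξ) := by
    refine integral_congr_ae ?_
    filter_upwards [Lp.coeFn_smul c g] with ξ hξ
    rw [hξ, Pi.smul_apply, smul_comm]
  rw [e1, e2, integral_smul, integral_smul, h φ hφ hc hs, smul_neg]

lemma IsWeakDeriv.unique {ζ g g' : L2} (h : IsWeakDeriv ζ g) (h' : IsWeakDeriv ζ g') :
    g = g' := by
  have hloc : LocallyIntegrableOn (fun ξ => g ξ - g' ξ) (Ioo (0 : ℝ) 1) volume :=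
    (show IntegrableOn (fun ξ => g ξ - g' ξ) (Ioo (0 : ℝ) 1) volume from
      (integrable_L2 g).sub (integrable_L2 g')).locallyIntegrableOn
  have key := isOpen_Ioo.ae_eq_zero_of_integral_contDiff_smul_eq_zero hloc (by
    intro φ hφ hc hs
    have h0 : ∫ ξ in Ioo (0 : ℝ) 1, φ ξ • (g ξ - g' ξ) = 0 := by
      simp only [smul_sub]
      rw [integral_sub (integrable_smul_of_continuous hφ.continuous hc g)
        (integrable_smul_of_continuous hφ.continuous hc g'),
        ← neg_inj, neg_sub, neg_zero, sub_eq_zero, ← neg_inj, ← h φ hφ hc hs, ← h' φ hφ hc hs]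
    rw [← h0, setIntegral_eq_integral_of_forall_compl_eq_zero]
    intro ξ hξ
    have : φ ξ = 0 := image_eq_zero_of_notMem_tsupport fun hh => hξ (hs hh)
    simp [this])
  refine Lp.ext ?_
  rw [EventuallyEq, ae_restrict_iff' measurableSet_Ioo]
  filter_upwards [key] with ξ hξ hm
  exact sub_eq_zero.1 (hξ hm)

lemma IsContRep.add {ζ ζ' : L2} {w w' : ℝ → R2} (h : IsContRep ζ w) (h' : IsContRep ζ' w') :
    IsContRep (ζ + ζ') (w + w') :=
  ⟨h.1.add h'.1, (Lp.coeFn_add ζ ζ').trans (h.2.add h'.2)⟩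

lemma IsContRep.smul {ζ : L2} {w : ℝ → R2} (c : ℝ) (h : IsContRep ζ w) :
    IsContRep (c • ζ) (c • w) :=
  ⟨h.1.const_smul c, (Lp.coeFn_smul c ζ).trans (h.2.const_smul c)⟩

lemma IsContRep.unique {ζ : L2} {w w' : ℝ → R2} (h : IsContRep ζ w) (h' : IsContRep ζ w') :
    EqOn w w' (Icc 0 1) := by
  have hoo : EqOn w w' (Ioo 0 1) := by
    have hae : w =ᵐ[vol01] w' := h.2.symm.trans h'.2
    exact Measure.eqOn_open_of_ae_eq hae isOpen_Ioo
      (h.1.mono Ioo_subset_Icc_self) (h'.1.mono Ioo_subset_Icc_self)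
  refine hoo.of_subset_closure h.1 h'.1 Ioo_subset_Icc_self ?_
  rw [closure_Ioo (by norm_num)]

/-- The space `H¹((0,1);ℝ²)`: square-integrable functions with square-integrable weak
derivative. -/
def H1 : Submodule ℝ L2 where
  carrier := {ζ | ∃ g : L2, IsWeakDeriv ζ g}
  zero_mem' := ⟨0, fun φ _ _ _ => by
    have h0 : ∀ ψ : ℝ → ℝ, ∫ ξ in Ioo (0 : ℝ) 1, ψ ξ • (0 : L2) ξ = 0 := fun ψ => by
      refine integral_eq_zero_of_ae ?_
      filter_upwards [Lp.coeFn_zero R2 2 vol01] with ξ hξ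
      rw [hξ, Pi.zero_apply, smul_zero]
    rw [h0, h0, neg_zero]⟩
  add_mem' := fun ⟨g, hg⟩ ⟨g', hg'⟩ => ⟨g + g', hg.add hg'⟩
  smul_mem' := fun c _ ⟨g, hg⟩ => ⟨c • g, hg.smul c⟩

/-- The weak derivative `∂/∂ξ : H¹((0,1);ℝ²) → L²((0,1);ℝ²)`. -/
def weakDeriv : H1 →ₗ[ℝ] L2 where
  toFun ζ := ζ.2.choose
  map_add' ζ ζ' := (ζ + ζ').2.choose_spec.unique (ζ.2.choose_spec.add ζ'.2.choose_spec)
  map_smul' c ζ := (c • ζ).2.choose_spec.unique (ζ.2.choose_spec.smul c)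

/-- The common domain `{ζ ∈ H¹((0,1);ℝ²) : ζ(0) = 0}` of the operators below. -/
def dom : Submodule ℝ L2 where
  carrier := {ζ | ζ ∈ H1 ∧ ∃ w : ℝ → R2, IsContRep ζ w ∧ w 0 = 0}
  zero_mem' := ⟨H1.zero_mem, 0, ⟨continuousOn_const, Lp.coeFn_zero R2 2 vol01⟩, rfl⟩
  add_mem' := fun ⟨h, w, hw, h0⟩ ⟨h', w', hw', h0'⟩ =>
    ⟨H1.add_mem h h', w + w', hw.add hw', by simp [h0, h0']⟩
  smul_mem' := fun c _ ⟨h, w, hw, h0⟩ => ⟨H1.smul_mem c h, c • w, hw.smul c, by simp [h0]⟩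

lemma dom_le_H1 : dom ≤ H1 := fun _ h => h.1

/-- The boundary value `ζ ↦ ζ(1)`, read off from the continuous representative of `ζ`. -/
def valueAtOne : dom →ₗ[ℝ] R2 where
  toFun ζ := ζ.2.2.choose 1
  map_add' ζ ζ' := (ζ + ζ').2.2.choose_spec.1.unique
    (ζ.2.2.choose_spec.1.add ζ'.2.2.choose_spec.1) (by simp)
  map_smul' c ζ := (c • ζ).2.2.choose_spec.1.unique (ζ.2.2.choose_spec.1.smul c) (by simp)

/-! ### Integral operators -/

lemma integrable_act {K : ℝ → M2} (hK : ContinuousOn K (Icc 0 1)) (ζ : L2) :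
    Integrable (fun ξ => act (K ξ) (ζ ξ)) vol01 := by
  have hcont : Continuous (act : M2 → R2 →L[ℝ] R2) :=
    LinearMap.continuous_of_finiteDimensional
      (Matrix.toEuclideanCLM (n := Fin 2) (𝕜 := ℝ)).toAlgEquiv.toLinearMap
  have hKa : ContinuousOn (fun ξ => act (K ξ)) (Icc 0 1) := hcont.comp_continuousOn hK
  obtain ⟨C, hC⟩ := isCompact_Icc.exists_bound_of_continuousOn hKa
  have hm : AEStronglyMeasurable (fun ξ => act (K ξ)) vol01 :=
    (hKa.mono Ioo_subset_Icc_self).aestronglyMeasurable measurableSet_Ioo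
  refine ((integrable_L2 ζ).norm.const_mul C).mono'
    ((ContinuousLinearMap.id ℝ (R2 →L[ℝ] R2)).aestronglyMeasurable_comp₂ hm
      (Lp.aestronglyMeasurable ζ)) ?_
  filter_upwards [ae_restrict_mem measurableSet_Ioo] with ξ hξ
  exact (act (K ξ)).le_of_opNorm_le (hC ξ (Ioo_subset_Icc_self hξ)) _

/-- The operator `ζ ↦ ∫₀¹ K(ξ) ζ(ξ) dξ` from `L²((0,1);ℝ²)` to `ℝ²`. -/
def integralOp (K : ℝ → M2) (hK : ContinuousOn K (Icc 0 1)) : L2 →ₗ[ℝ] R2 where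
  toFun ζ := ∫ ξ in Ioo (0 : ℝ) 1, act (K ξ) (ζ ξ)
  map_add' ζ ζ' := by
    rw [← integral_add (integrable_act hK ζ) (integrable_act hK ζ')]
    refine integral_congr_ae ?_
    filter_upwards [Lp.coeFn_add ζ ζ'] with ξ hξ
    rw [hξ, Pi.add_apply, map_add]
  map_smul' c ζ := by
    rw [RingHom.id_apply, ← integral_smul]
    refine integral_congr_ae ?_
    filter_upwards [Lp.coeFn_smul c ζ] with ξ hξ
    rw [hξ, Pi.smul_apply, map_smul]

/-- The constant function on `(0,1)` with value `v`, as an element of `L²((0,1);ℝ²)`. -/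
abbrev constL2 : R2 →L[ℝ] L2 := Lp.constL 2 vol01 ℝ

/-- Pointwise multiplication by a constant matrix, `(M ζ)(ξ) = M ζ(ξ)`, on `L²((0,1);ℝ²)`. -/
abbrev mulL2 (M : M2) : L2 →L[ℝ] L2 := (act M).compLpL 2 vol01

/-! ### The friction model -/

/-- The coefficients of the distributed friction model
`∂ₜz + Λ ∂ξz = θ Σ(v) [z + 𝒦₂ z] + 𝒦₃ z + H v`, `z(0,t) = 0`, with output `𝒦₁ z`. -/
structure Model where
  /-- the matrix `Λ` of transport velocities -/
  Lam : M2
  /-- the input matrix `H` -/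
  H : M2
  K₁ : ℝ → M2
  K₂ : ℝ → M2
  K₃ : ℝ → M2
  K₄ : M2
  /-- the source matrix `Σ` -/
  Sig : R2 → M2
  θ : ℝ
  Lam_posDef : Lam.PosDef
  H_symm : H.IsSymm
  H_isUnit : IsUnit H
  K₁_cont : ContinuousOn K₁ (Icc 0 1)
  K₁_symm : ∀ ξ ∈ Icc (0 : ℝ) 1, (K₁ ξ).IsSymm
  K₁_isUnit : ∀ ξ ∈ Icc (0 : ℝ) 1, IsUnit (K₁ ξ)
  K₂_cont : ContinuousOn K₂ (Icc 0 1)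
  K₃_cont : ContinuousOn K₃ (Icc 0 1)
  Sig_cont : Continuous Sig
  θ_nonneg : 0 ≤ θ
  /-- `𝒬(ξ) = K₁(ξ) H⁻¹` is symmetric and positive definite. -/
  Q_posDef : ∀ ξ ∈ Icc (0 : ℝ) 1, (K₁ ξ * H⁻¹).PosDef

namespace Model

variable (P : Model)

/-- The weight `𝒬(ξ) = K₁(ξ) H⁻¹`. -/
def Q (ξ : ℝ) : M2 := P.K₁ ξ * P.H⁻¹

/-- `⟨f, 𝒬 ζ⟩` in `L²((0,1);ℝ²)`, that is `∫₀¹ f(ξ)ᵀ 𝒬(ξ) ζ(ξ) dξ`. -/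
def pairQ (f ζ : L2) : ℝ := ∫ ξ in Ioo (0 : ℝ) 1, inner ℝ (f ξ) (act (P.Q ξ) (ζ ξ))

/-- `𝒦₂ ζ = ∫₀¹ K₂(ξ) ζ(ξ) dξ`. -/
def opK₂ : L2 →ₗ[ℝ] R2 := integralOp P.K₂ P.K₂_cont

/-- `𝒦₃ ζ = ∫₀¹ K₃(ξ) ζ(ξ) dξ + K₄ ζ(1)`. -/
def opK₃ : dom →ₗ[ℝ] R2 :=
  integralOp P.K₃ P.K₃_cont ∘ₗ dom.subtype + (act P.K₄).toLinearMap ∘ₗ valueAtOne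

/-- The action `𝒜 ζ = -Λ ∂ζ/∂ξ + 𝒦₃ ζ`. -/
def mapA : dom →ₗ[ℝ] L2 :=
  -((mulL2 P.Lam).toLinearMap ∘ₗ weakDeriv ∘ₗ Submodule.inclusion dom_le_H1)
    + constL2.toLinearMap ∘ₗ P.opK₃

/-- The unbounded operator `𝒜 ζ = -Λ ∂ζ/∂ξ + 𝒦₃ ζ` with domain `{ζ ∈ H¹ : ζ(0) = 0}`. -/
def opA : L2 →ₗ.[ℝ] L2 where
  domain := dom
  toFun := P.mapA

/-- The bounded operator `ζ ↦ Σ(y) [ζ + 𝒦₂ ζ]` on `L²((0,1);ℝ²)`. -/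
def source (y : R2) : L2 →ₗ[ℝ] L2 :=
  (mulL2 (P.Sig y)).toLinearMap ∘ₗ (LinearMap.id + constL2.toLinearMap ∘ₗ P.opK₂)

/-- The unbounded operator `𝒜_Σ(y) ζ = θ Σ(y) [ζ + 𝒦₂ ζ] + 𝒜 ζ` with domain `{ζ ∈ H¹ : ζ(0) = 0}`. -/
def opASig (y : R2) : L2 →ₗ.[ℝ] L2 where
  domain := dom
  toFun := P.θ • (P.source y ∘ₗ dom.subtype) + P.mapA

/-- Strict dissipativity of the unbounded operator `A` with weight `𝒬` and rate `ω`: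
`⟨A ζ, 𝒬 ζ⟩ ≤ -ω ‖ζ‖²` for all `ζ` in the domain of `A`. -/
def StrictlyDissipative (A : L2 →ₗ.[ℝ] L2) (ω : ℝ) : Prop :=
  ∀ ζ : A.domain, P.pairQ (A ζ) ζ ≤ -ω * ‖(ζ : L2)‖ ^ 2

/-- Dissipativity and global Lipschitz continuity of the source matrix:
`∫₀¹ ζ(ξ)ᵀ 𝒬(ξ) Σ(y) [ζ(ξ) + 𝒦₂ ζ] dξ ≤ 0` for all `y ∈ ℝ²` and `ζ ∈ L²((0,1);ℝ²)`, and
`‖Σ(y₁) - Σ(y₂)‖ ≤ L ‖y₁ - y₂‖` for some `L ≥ 0`. -/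
def SourceDissipativeLipschitz : Prop :=
  (∀ (y : R2) (ζ : L2),
    ∫ ξ in Ioo (0 : ℝ) 1,
      inner ℝ (ζ ξ) (act (P.Q ξ) (act (P.Sig y) (ζ ξ + P.opK₂ ζ))) ≤ 0) ∧
  ∃ L : ℝ, 0 ≤ L ∧ ∀ y₁ y₂ : R2, ‖act (P.Sig y₁ - P.Sig y₂)‖ ≤ L * ‖y₁ - y₂‖

end Model

end TireFriction

end

open MeasureTheory Set Filter Topology
open scoped NNReal ENNReal

noncomputable section

/-! ### Generation of contraction semigroups for an equivalent inner product -/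

namespace LumerPhillips

variable {X : Type*} [NormedAddCommGroup X] [NormedSpace ℝ X]

/-! As `𝒬` is continuous and positive definite on the compact interval, `pairQ` is an inner product
equivalent to that of `L2`. The dissipativity bound for `𝒜_Σ(y)` is assumption 1 plus `θ ≥ 0` times
assumption 2. Measured in this inner product, the bound makes `𝒜_Σ(y) + ε` dissipative for a small
`ε > 0`. A Lumer–Phillips theorem for equivalent inner products
(`exists_c0Semigroup_of_dissipative`, by Yosida approximation) then yields a bounded semigroup, and
the factor `e^{-εt}` gives exponential decay.

The range condition is `exists_smul_sub_opASig_eq`. Without the nonlocal terms, `l - 𝒜_Σ(y)` is a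
linear ODE operator with zero initial value, onto by variation of constants. The nonlocal terms,
including the trace at `1`, factor through `ℝ²`, so surjectivity reduces to injectivity, which
strict dissipativity supplies. -/

/-- `R` is the resolvent `(l - A)⁻¹`. -/
def IsResolvent (A : X →ₗ.[ℝ] X) (l : ℝ) (R : X →L[ℝ] X) : Prop :=
  (∀ f, ∃ h : R f ∈ A.domain, l • R f - A ⟨R f, h⟩ = f) ∧
    ∀ x : A.domain, R (l • (x : X) - A x) = x

/-- The Yosida approximation `l (l R - 1)` built from the resolvent `R = (l - A)⁻¹`. -/
def yosida (l : ℝ) (R : X →L[ℝ] X) : X →L[ℝ] X := l • (l • R - 1)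

lemma yosida_apply (l : ℝ) (R : X →L[ℝ] X) (x : X) :
    yosida l R x = l • (l • R x - x) := by simp [yosida]

lemma IsResolvent.yosida_apply_domain {A : X →ₗ.[ℝ] X} {l : ℝ} {R : X →L[ℝ] X}
    (h : IsResolvent A l R) (x : A.domain) : yosida l R x = l • R (A x) := by
  have := h.2 x
  rw [map_sub, map_smul] at this
  rw [yosida_apply]
  congr 1
  nth_rewrite 2 [← this]
  abel

/-- The resolvent identity: write `x = (m - A) S x` and apply `R`. -/
lemma IsResolvent.sub_eq {A : X →ₗ.[ℝ] X} {l m : ℝ} {R S : X →L[ℝ] X}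
    (hR : IsResolvent A l R) (hS : IsResolvent A m S) (x : X) :
    R x - S x = (m - l) • R (S x) := by
  obtain ⟨h, hx⟩ := hS.1 x
  have h2 := hR.2 ⟨S x, h⟩
  have h3 : A ⟨S x, h⟩ = m • S x - x := by
    conv_rhs => enter [2]; rw [← hx]
    abel
  simp only [h3, map_sub, map_smul] at h2
  rw [sub_smul, ← sub_eq_zero]
  conv_lhs => enter [1, 2]; rw [← h2]
  abel

lemma IsResolvent.commute {A : X →ₗ.[ℝ] X} {l m : ℝ} {R S : X →L[ℝ] X}
    (hR : IsResolvent A l R) (hS : IsResolvent A m S) : Commute R S := by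
  ext x
  change R (S x) = S (R x)
  have h1 := hR.sub_eq hS x
  have h2 := hS.sub_eq hR x
  rcases eq_or_ne m l with rfl | hne
  · have : ∀ z, R z = S z := fun z => by
      have := hR.sub_eq hS z
      rwa [sub_self, zero_smul, sub_eq_zero] at this
    rw [this, this x]
  · have h3 : (m - l) • R (S x) = (m - l) • S (R x) := by
      rw [← h1, ← neg_sub (S x), h2, ← neg_smul, neg_sub]
    exact smul_right_injective X (sub_ne_zero.2 hne) h3

lemma IsResolvent.commute_yosida {A : X →ₗ.[ℝ] X} {l m : ℝ} {R S : X →L[ℝ] X}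
    (hR : IsResolvent A l R) (hS : IsResolvent A m S) : Commute (yosida l R) (yosida m S) :=
  ((((hR.commute hS).smul_left l).smul_right m).sub_right (Commute.one_right _)
    |>.sub_left ((Commute.one_left _)) |>.smul_left l).smul_right m

/-! ### Dissipative operators and their Yosida approximations with respect to a form `q`. -/

section Form

variable {q : X →L[ℝ] X →L[ℝ] ℝ} {M : ℝ}

/-- Expanding `q (u - v) (u - v) ≥ 0` gives a substitute for Cauchy–Schwarz that suffices for all
contraction estimates. -/
lemma form_le_half (hsymm : ∀ u v, q u v = q v u) (hpos : ∀ u, 0 ≤ q u u) (u v : X) :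
    q u v ≤ (q u u + q v v) / 2 := by
  have h := hpos (u - v)
  simp only [map_sub, sub_apply] at h
  linarith [hsymm u v]

lemma exists_isResolvent (hsymm : ∀ u v, q u v = q v u) (hpos : ∀ u, 0 ≤ q u u)
    (hM : ∀ u v, q u u ≤ q v v → ‖u‖ ≤ M * ‖v‖) {A : X →ₗ.[ℝ] X}
    (hA : ∀ x : A.domain, q (A x) x ≤ 0) {l : ℝ} (hl : 0 < l)
    (hsurj : ∀ f, ∃ x : A.domain, l • (x : X) - A x = f) :
    ∃ R : X →L[ℝ] X, IsResolvent A l R ∧ ∀ f, ‖l • R f‖ ≤ M * ‖f‖ := by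
  -- With `f = l x - A x`, dissipativity gives `q(lx, lx) ≤ q(f, lx)`, hence `q(lx, lx) ≤ q(f, f)`;
  -- `hM` turns this `q`-contraction into a norm bound.
  have bound : ∀ x : A.domain, ‖l • (x : X)‖ ≤ M * ‖l • (x : X) - A x‖ := fun x => by
    refine hM _ _ ?_
    have h1 := form_le_half hsymm hpos (l • (x : X) - A x) (l • (x : X))
    have h2 : q (l • (x : X)) (l • (x : X)) ≤ q (l • (x : X) - A x) (l • (x : X)) := by
      have := hA x
      simp only [map_sub, sub_apply, map_smul, smul_apply, smul_eq_mul]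
      nlinarith
    linarith
  have inj : ∀ x : A.domain, l • (x : X) - A x = 0 → x = 0 := fun x hx => by
    have := bound x
    rw [hx, norm_zero, mul_zero, norm_le_zero_iff] at this
    exact Subtype.ext ((smul_eq_zero.1 this).resolve_left hl.ne')
  let L : A.domain →ₗ[ℝ] X := l • A.domain.subtype - A.toFun
  have hLapp : ∀ x, L x = l • (x : X) - A x := fun x => rfl
  let e : A.domain ≃ₗ[ℝ] X := LinearEquiv.ofBijective L
    ⟨(injective_iff_map_eq_zero L).2 inj, hsurj⟩
  have he : ∀ f, l • ((e.symm f : A.domain) : X) - A (e.symm f) = f := fun f =>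
    e.apply_symm_apply f
  have hb : ∀ f, ‖l • ((e.symm f : A.domain) : X)‖ ≤ M * ‖f‖ := fun f => by
    have := bound (e.symm f); rwa [he] at this
  refine ⟨(A.domain.subtype ∘ₗ e.symm.toLinearMap).mkContinuous (l⁻¹ * M) fun f => ?_, ⟨?_, ?_⟩, ?_⟩
  · have := hb f
    rw [norm_smul, Real.norm_of_nonneg hl.le] at this
    rw [mul_assoc]
    exact (le_inv_mul_iff₀ hl).2 this
  · exact fun f => ⟨(e.symm f).2, he f⟩
  · exact fun x => congrArg Subtype.val (e.symm_apply_apply x)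
  · exact hb

/-- For `w = A R u` one has `u = l R u - w`, so the form equals `l (l q(w, R u) - q(w, w))`, and
both terms are nonpositive. -/
lemma form_yosida_nonpos (hpos : ∀ u, 0 ≤ q u u) {A : X →ₗ.[ℝ] X}
    (hA : ∀ x : A.domain, q (A x) x ≤ 0) {l : ℝ} (hl : 0 < l) {R : X →L[ℝ] X}
    (hR : IsResolvent A l R) (u : X) : q (yosida l R u) u ≤ 0 := by
  obtain ⟨h, hu⟩ := hR.1 u
  have e1 : l • R u - u = A ⟨R u, h⟩ := by nth_rewrite 2 [← hu]; abel
  rw [yosida_apply, e1]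
  have h1 := hA ⟨R u, h⟩
  have h2 := hpos (A ⟨R u, h⟩)
  have e3 : q (A ⟨R u, h⟩) u = l * q (A ⟨R u, h⟩) (R u) - q (A ⟨R u, h⟩) (A ⟨R u, h⟩) := by
    rw [← smul_eq_mul, ← map_smul, ← map_sub, hu]
  simp only [map_smul, smul_apply, smul_eq_mul] at h1 ⊢
  have : l * q (A ⟨R u, h⟩) (R u) ≤ 0 := mul_nonpos_of_nonneg_of_nonpos hl.le h1
  exact mul_nonpos_of_nonneg_of_nonpos hl.le (by linarith)

variable [CompleteSpace X]

lemma hasDerivAt_exp_smul_apply (B : X →L[ℝ] X) (x : X) (t : ℝ) :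
    HasDerivAt (fun s : ℝ => NormedSpace.exp (s • B) x) (NormedSpace.exp (t • B) (B x)) t :=
  (hasDerivAt_exp_smul_const (𝕂 := ℝ) B t).clm_apply (hasDerivAt_const t x) |>.congr_deriv (by simp)

lemma hasDerivAt_exp_smul_apply' (B : X →L[ℝ] X) (x : X) (t : ℝ) :
    HasDerivAt (fun s : ℝ => NormedSpace.exp (s • B) x) (B (NormedSpace.exp (t • B) x)) t :=
  (hasDerivAt_exp_smul_const' (𝕂 := ℝ) B t).clm_apply (hasDerivAt_const t x)
    |>.congr_deriv (by simp)

/-- Along the orbit `u(s)` the derivative of `q(u, u)` is `2 q(B u, u) ≤ 0`. -/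
lemma form_exp_smul_apply_le (hsymm : ∀ u v, q u v = q v u) {B : X →L[ℝ] X}
    (hB : ∀ u, q (B u) u ≤ 0) {t : ℝ} (ht : 0 ≤ t) (x : X) :
    q (NormedSpace.exp (t • B) x) (NormedSpace.exp (t • B) x) ≤ q x x := by
  have hd : ∀ s : ℝ, HasDerivAt
      (fun s : ℝ => q (NormedSpace.exp (s • B) x) (NormedSpace.exp (s • B) x))
      (q (B (NormedSpace.exp (s • B) x)) (NormedSpace.exp (s • B) x)
        + q (NormedSpace.exp (s • B) x) (B (NormedSpace.exp (s • B) x))) s := fun s => by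
    have h := hasDerivAt_exp_smul_apply' B x s
    exact (q.hasFDerivAt.comp_hasDerivAt s h).clm_apply h
  have hanti := antitone_of_deriv_nonpos (fun s => (hd s).differentiableAt) fun s => by
    rw [(hd s).deriv, hsymm (NormedSpace.exp (s • B) x)]
    linarith [hB (NormedSpace.exp (s • B) x)]
  simpa using hanti ht

end Form

/-! ### Mean value estimates for exponentials. -/

section Approximation

variable [CompleteSpace X] {M : ℝ}

/-- The path `s ↦ e^{(t-s)B'} e^{sB} x` joins the two vectors; commutation reduces its derivative to
`e^{(t-s)B'} e^{sB} (B x - B' x)`. -/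
lemma norm_exp_sub_exp_le {B B' : X →L[ℝ] X} (hM0 : 0 ≤ M) (hc : Commute B B')
    (hB : ∀ t : ℝ, 0 ≤ t → ∀ x, ‖NormedSpace.exp (t • B) x‖ ≤ M * ‖x‖)
    (hB' : ∀ t : ℝ, 0 ≤ t → ∀ x, ‖NormedSpace.exp (t • B') x‖ ≤ M * ‖x‖)
    {t : ℝ} (ht : 0 ≤ t) (x : X) :
    ‖NormedSpace.exp (t • B) x - NormedSpace.exp (t • B') x‖
      ≤ M * (M * ‖B x - B' x‖) * t := by
  have hd : ∀ s ∈ Icc 0 t, HasDerivWithinAt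
      (fun s : ℝ => NormedSpace.exp ((t - s) • B') (NormedSpace.exp (s • B) x))
      (NormedSpace.exp ((t - s) • B') (NormedSpace.exp (s • B) (B x - B' x))) (Icc 0 t) s := by
    intro s _
    have h1 := hasDerivAt_exp_smul_apply B x s
    have h2 : HasDerivAt (fun s : ℝ => NormedSpace.exp ((t - s) • B'))
        (-(NormedSpace.exp ((t - s) • B') * B')) s := by
      have := (hasDerivAt_exp_smul_const (𝕂 := ℝ) B' (t - s)).scomp s
        ((hasDerivAt_id s).const_sub t)
      exact this.congr_deriv (by simp)
    refine ((h2.clm_apply h1).congr_deriv ?_).hasDerivWithinAt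
    have hc' : B' (NormedSpace.exp (s • B) x) = NormedSpace.exp (s • B) (B' x) := by
      have := ((hc.symm.smul_right s).exp_right)
      exact DFunLike.congr_fun this.eq x
    simp only [neg_apply, mul_apply_eq_comp, hc', map_sub]
    abel
  have h := (convex_Icc (0 : ℝ) t).norm_image_sub_le_of_norm_hasDerivWithin_le hd
    (C := M * (M * ‖B x - B' x‖)) (fun s hs => (hB' _ (sub_nonneg.2 hs.2) _).trans
      (mul_le_mul_of_nonneg_left (hB s hs.1 _) hM0)) ⟨le_rfl, ht⟩ ⟨ht, le_rfl⟩
  simpa [abs_of_nonneg ht] using h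

lemma norm_exp_sub_sub_le {B : X →L[ℝ] X} {x y : X} {h ε : ℝ} (hh : 0 ≤ h)
    (hε : ∀ s ∈ Icc 0 h, ‖NormedSpace.exp (s • B) (B x) - y‖ ≤ ε) :
    ‖NormedSpace.exp (h • B) x - x - h • y‖ ≤ ε * h := by
  have hd : ∀ s ∈ Icc 0 h, HasDerivWithinAt (fun s : ℝ => NormedSpace.exp (s • B) x - s • y)
      (NormedSpace.exp (s • B) (B x) - y) (Icc 0 h) s := fun s _ => by
    have := (hasDerivAt_exp_smul_apply B x s).sub ((hasDerivAt_id s).smul_const y)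
    exact this.hasDerivWithinAt.congr_deriv (by simp)
  have := (convex_Icc (0 : ℝ) h).norm_image_sub_le_of_norm_hasDerivWithin_le hd hε
    ⟨le_rfl, hh⟩ ⟨hh, le_rfl⟩
  simp only [zero_smul, NormedSpace.exp_zero, sub_zero, Real.norm_of_nonneg hh,
    one_apply_eq_self] at this
  rwa [sub_right_comm] at this

end Approximation

end LumerPhillips

/-! ### The limit semigroup of commuting, uniformly bounded exponentials. -/

namespace LumerPhillips

variable {X : Type*} [NormedAddCommGroup X] [NormedSpace ℝ X] [CompleteSpace X] {M : ℝ}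

section Limit

variable {B : ℕ → X →L[ℝ] X}

lemma uniformCauchySeqOn_exp (hM0 : 0 ≤ M) (hc : ∀ m n, Commute (B m) (B n))
    (hB : ∀ n, ∀ t : ℝ, 0 ≤ t → ∀ x, ‖NormedSpace.exp (t • B n) x‖ ≤ M * ‖x‖)
    {D : Set X} (hD : Dense D) (hcau : ∀ x ∈ D, CauchySeq fun n => B n x) (x : X) {K : ℝ}
    (hK : 0 ≤ K) :
    UniformCauchySeqOn (fun n (t : ℝ) => NormedSpace.exp (t • B n) x) atTop (Icc 0 K) := by
  rw [Metric.uniformCauchySeqOn_iff]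
  intro ε hε
  -- Replacing `x` by `z ∈ D` costs at most `ε/3` for each exponential. The `+ 1` keeps the
  -- denominators positive when `M` or `K` vanishes.
  obtain ⟨z, hz, hxz⟩ := Metric.dense_iff.1 hD x (ε / (3 * (M + 1))) (by positivity)
  rw [Metric.mem_ball, dist_comm, dist_eq_norm] at hz
  have hxz' : M * ‖x - z‖ ≤ ε / 3 := by
    rw [lt_div_iff₀ (by positivity)] at hz
    nlinarith [norm_nonneg (x - z)]
  obtain ⟨N, hN⟩ := Metric.cauchySeq_iff.1 (hcau z hxz) (ε / (3 * (M * M * K + 1)))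
    (by positivity)
  refine ⟨N, fun m hm n hn t ht => ?_⟩
  have h1 := hN m hm n hn
  rw [dist_eq_norm, lt_div_iff₀ (by positivity)] at h1
  have h2 := norm_exp_sub_exp_le hM0 (hc m n) (hB m) (hB n) ht.1 z
  have h3 : M * (M * ‖B m z - B n z‖) * t < ε / 3 := by
    have : M * (M * ‖B m z - B n z‖) * t ≤ M * (M * ‖B m z - B n z‖) * K :=
      mul_le_mul_of_nonneg_left ht.2 (by positivity)
    have h0 : 0 ≤ ‖B m z - B n z‖ := norm_nonneg _
    rcases h0.eq_or_lt with h0 | h0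
    · rw [← h0] at this; simp at this; rw [← h0]; simp; positivity
    · nlinarith
  have h4 := hB m t ht.1 (x - z)
  have h5 := hB n t ht.1 (x - z)
  rw [dist_eq_norm]
  have e : NormedSpace.exp (t • B m) x - NormedSpace.exp (t • B n) x
      = NormedSpace.exp (t • B m) (x - z) - NormedSpace.exp (t • B n) (x - z)
        + (NormedSpace.exp (t • B m) z - NormedSpace.exp (t • B n) z) := by
    simp only [map_sub]; abel
  rw [e]
  calc _ ≤ _ := norm_add_le _ _
    _ ≤ _ := add_le_add_left (norm_sub_le _ _) _
    _ < ε := by linarith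

/-- The second conclusion is only one inclusion between the generator and the limit of the `B n`;
the other needs a range condition. -/
theorem exists_c0Semigroup_of_exp (hM0 : 0 ≤ M) (hc : ∀ m n, Commute (B m) (B n))
    (hB : ∀ n, ∀ t : ℝ, 0 ≤ t → ∀ x, ‖NormedSpace.exp (t • B n) x‖ ≤ M * ‖x‖)
    {D : Set X} (hD : Dense D) (hcau : ∀ x ∈ D, CauchySeq fun n => B n x) :
    ∃ T : C0Semigroup X,
      (∀ (t : ℝ≥0) x,
        Tendsto (fun n => NormedSpace.exp ((t : ℝ) • B n) x) atTop (𝓝 (T.toFun t x))) ∧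
      ∀ x y, Tendsto (fun n => B n x) atTop (𝓝 y) →
        Tendsto (fun h : ℝ≥0 => (h : ℝ)⁻¹ • (T.toFun h x - x)) (𝓝[>] 0) (𝓝 y) := by
  have hcs : ∀ (t : ℝ≥0) x, CauchySeq fun n => NormedSpace.exp ((t : ℝ) • B n) x := fun t x =>
    (uniformCauchySeqOn_exp hM0 hc hB hD hcau x t.2).cauchySeq ⟨t.2, le_rfl⟩
  choose f hf using fun t x => cauchySeq_tendsto_of_complete (hcs t x)
  have hfM : ∀ t x, ‖f t x‖ ≤ M * ‖x‖ := fun t x =>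
    le_of_tendsto (hf t x).norm (Eventually.of_forall fun n => hB n t t.2 x)
  let F : ℝ≥0 → X →L[ℝ] X := fun t => LinearMap.mkContinuous
    { toFun := f t
      map_add' := fun x y => tendsto_nhds_unique (hf t (x + y)) <| by
        simpa only [map_add] using (hf t x).add (hf t y)
      map_smul' := fun c x => tendsto_nhds_unique (hf t (c • x)) <| by
        simpa only [map_smul, RingHom.id_apply] using (hf t x).const_smul c } M (hfM t)
  have hF : ∀ (t : ℝ≥0) x, Tendsto (fun n => NormedSpace.exp ((t : ℝ) • B n) x) atTop (𝓝 (F t x)) := hf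
  have hunif : ∀ x (K : ℝ), 0 ≤ K → TendstoUniformlyOn
      (fun n (t : ℝ) => NormedSpace.exp (t • B n) x) (fun t => F t.toNNReal x) atTop (Icc 0 K) :=
    fun x K hK => (uniformCauchySeqOn_exp hM0 hc hB hD hcau x hK).tendstoUniformlyOn_of_tendsto
      fun t ht => by simpa [Real.coe_toNNReal t ht.1] using hF t.toNNReal x
  have h0 : F 0 = ContinuousLinearMap.id ℝ X := by
    ext x
    refine tendsto_nhds_unique (hF 0 x) ?_
    simp
  have hcont : ∀ x, Continuous fun t => F t x := by
    intro x
    have hon : ∀ K : ℝ, 0 ≤ K → ContinuousOn (fun t : ℝ => F t.toNNReal x) (Icc 0 K) :=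
      fun K hK => (hunif x K hK).continuousOn <| Frequently.of_forall fun n =>
        (continuous_iff_continuousAt.2 fun t =>
          (hasDerivAt_exp_smul_apply (B n) x t).continuousAt).continuousOn
    rw [continuous_iff_continuousAt]
    intro t
    have h1 := (hon (t + 1) (by positivity)) t ⟨t.2, by simp⟩
    have h2 : Tendsto (fun s : ℝ≥0 => (s : ℝ)) (𝓝 t) (𝓝[Icc 0 ((t : ℝ) + 1)] (t : ℝ)) := by
      refine tendsto_nhdsWithin_iff.2 ⟨NNReal.continuous_coe.continuousAt, ?_⟩
      have : ∀ᶠ s : ℝ≥0 in 𝓝 t, (s : ℝ) < t + 1 :=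
        NNReal.continuous_coe.continuousAt.eventually_lt_const (by simp)
      filter_upwards [this] with s hs using ⟨s.2, hs.le⟩
    have h3 := h1.tendsto.comp h2
    simpa [ContinuousAt, Function.comp_def] using h3
  let T : C0Semigroup X :=
    { toFun := F
      map_zero := h0
      map_add := fun s t => by
        ext x
        refine tendsto_nhds_unique (hF (s + t) x) ?_
        have e : ∀ n, NormedSpace.exp (((s + t : ℝ≥0) : ℝ) • B n) x
            = NormedSpace.exp ((s : ℝ) • B n) (F t x)
              + NormedSpace.exp ((s : ℝ) • B n) (NormedSpace.exp ((t : ℝ) • B n) x - F t x) := by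
          intro n
          have : NormedSpace.exp (((s + t : ℝ≥0) : ℝ) • B n)
              = NormedSpace.exp ((s : ℝ) • B n) * NormedSpace.exp ((t : ℝ) • B n) := by
            rw [NNReal.coe_add, add_smul]
            let _ : NormedAlgebra ℚ (X →L[ℝ] X) := NormedAlgebra.restrictScalars ℚ ℝ _
            exact NormedSpace.exp_add_of_commute
              (((Commute.refl (B n)).smul_left _).smul_right _)
          rw [this, mul_apply_eq_comp, map_sub]
          abel
        have hz : Tendsto (fun n => NormedSpace.exp ((s : ℝ) • B n)
            (NormedSpace.exp ((t : ℝ) • B n) x - F t x)) atTop (𝓝 0) := by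
          refine squeeze_zero_norm (fun n => hB n s s.2 _) ?_
          simpa using ((tendsto_iff_norm_sub_tendsto_zero.1 (hF t x)).const_mul M)
        simpa only [e, add_zero, ContinuousLinearMap.comp_apply] using (hF s (F t x)).add hz
      continuous_orbit := hcont }
  refine ⟨T, hF, fun x y hxy => ?_⟩
  rw [Metric.tendsto_nhds]
  intro ε hε
  have hev : ∀ᶠ s : ℝ≥0 in 𝓝 0, ‖F s y - y‖ < ε / 4 := by
    have h1 : Tendsto (fun s => ‖F s y - y‖) (𝓝 0) (𝓝 ‖F 0 y - y‖) :=
      ((hcont y).sub continuous_const).norm.continuousAt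
    exact h1.eventually_lt_const (by rw [h0]; simp; positivity)
  obtain ⟨δ, hδ, hδ'⟩ := Metric.eventually_nhds_iff.1 hev
  rw [eventually_nhdsWithin_iff]
  filter_upwards [Metric.ball_mem_nhds (0 : ℝ≥0) hδ] with h hh hpos
  have hpos' : (0 : ℝ) < h := hpos
  have hclose : ∀ s ∈ Icc 0 (h : ℝ), ‖F s.toNNReal y - y‖ < ε / 4 := fun s hs => by
    refine hδ' ?_
    have : (h : ℝ) < δ := by
      have := Metric.mem_ball.1 hh
      rwa [NNReal.dist_eq, NNReal.coe_zero, sub_zero, abs_of_nonneg (NNReal.coe_nonneg _)] at this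
    rw [NNReal.dist_eq, NNReal.coe_zero, sub_zero, abs_of_nonneg (NNReal.coe_nonneg _),
      Real.coe_toNNReal _ hs.1]
    exact hs.2.trans_lt this
  have hu := Metric.tendstoUniformlyOn_iff.1 (hunif y h h.2) (ε / 8) (by positivity)
  have hyn : ∀ᶠ n in atTop, M * ‖B n x - y‖ < ε / 8 := by
    have h1 := (tendsto_iff_norm_sub_tendsto_zero.1 hxy).const_mul M
    rw [mul_zero] at h1
    exact h1.eventually_lt_const (by positivity)
  -- For fixed `h`, the error is `ε/8` from `B n x → y`, `ε/8` from uniform convergence on `[0, h]`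
  -- and `ε/4` from continuity of the limit orbit of `y`.
  have hfin : ∀ᶠ n in atTop,
      ‖NormedSpace.exp ((h : ℝ) • B n) x - x - (h : ℝ) • y‖ ≤ ε / 2 * h := by
    filter_upwards [hu, hyn] with n hn1 hn2
    refine norm_exp_sub_sub_le h.2 fun s hs => ?_
    have a1 := hn1 s hs
    rw [dist_comm, dist_eq_norm] at a1
    have a2 := hclose s hs
    have a3 := hB n s hs.1 (B n x - y)
    have e : NormedSpace.exp (s • B n) (B n x) - y = NormedSpace.exp (s • B n) (B n x - y)
        + ((NormedSpace.exp (s • B n) y - F s.toNNReal y) + (F s.toNNReal y - y)) := by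
      rw [map_sub]; abel
    rw [e]
    refine (norm_add_le _ _).trans ((add_le_add_right (norm_add_le _ _) _).trans ?_)
    linarith
  have hlim := le_of_tendsto (((hF h x).sub_const x).sub_const ((h : ℝ) • y)).norm hfin
  rw [dist_eq_norm]
  have e : (h : ℝ)⁻¹ • (F h x - x) - y = (h : ℝ)⁻¹ • (F h x - x - (h : ℝ) • y) := by
    rw [smul_sub (h : ℝ)⁻¹ (F h x - x), smul_smul, inv_mul_cancel₀ hpos'.ne', one_smul]
  change ‖(h : ℝ)⁻¹ • (F h x - x) - y‖ < ε
  rw [e, norm_smul, norm_inv, Real.norm_of_nonneg hpos'.le]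
  calc _ ≤ (h : ℝ)⁻¹ * (ε / 2 * h) := by gcongr
    _ = ε / 2 := by field_simp
    _ < ε := by linarith

end Limit
end LumerPhillips

/-! ### Strong convergence, norm comparison and rescaling. -/

namespace LumerPhillips

section NormedSpace

variable {X : Type*} [NormedAddCommGroup X] [NormedSpace ℝ X] {M : ℝ}

lemma tendsto_of_dense {J : ℕ → X →L[ℝ] X} (hM0 : 0 ≤ M) (hJ : ∀ n x, ‖J n x‖ ≤ M * ‖x‖)
    {D : Set X} (hD : Dense D) (h : ∀ x ∈ D, Tendsto (fun n => J n x) atTop (𝓝 x)) (x : X) :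
    Tendsto (fun n => J n x) atTop (𝓝 x) := by
  rw [Metric.tendsto_nhds]
  intro ε hε
  obtain ⟨z, hz, hzD⟩ := Metric.dense_iff.1 hD x (ε / (2 * (M + 1))) (by positivity)
  rw [Metric.mem_ball, dist_comm, dist_eq_norm, lt_div_iff₀ (by positivity)] at hz
  filter_upwards [Metric.tendsto_nhds.1 (h z hzD) (ε / 2) (by positivity)] with n hn
  rw [dist_eq_norm] at hn ⊢
  have e : J n x - x = J n (x - z) + (J n z - z) - (x - z) := by rw [map_sub]; abel
  rw [e]
  refine (norm_sub_le _ _).trans_lt ((add_le_add_left (norm_add_le _ _) _).trans_lt ?_)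
  linarith [hJ n (x - z)]

/-- On the domain, `l R z - z = R (A z)` has size `O(1/l)`; density and the uniform bound do the
rest. -/
lemma tendsto_smul_resolvent {A : X →ₗ.[ℝ] X} (hM0 : 0 ≤ M) (hD : Dense (A.domain : Set X))
    {l : ℕ → ℝ} (hl0 : ∀ n, 0 < l n) (hl : Tendsto l atTop atTop) {R : ℕ → X →L[ℝ] X}
    (hR : ∀ n, IsResolvent A (l n) (R n)) (hb : ∀ n f, ‖l n • R n f‖ ≤ M * ‖f‖) (x : X) :
    Tendsto (fun n => l n • R n x) atTop (𝓝 x) := by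
  refine tendsto_of_dense (J := fun n => l n • R n) hM0 hb hD (fun z hz => ?_) x
  have e : ∀ n, (l n • R n) z - z = R n (A ⟨z, hz⟩) := fun n => by
    have := (hR n).2 ⟨z, hz⟩
    rw [map_sub, map_smul, sub_eq_iff_eq_add] at this
    rw [smul_apply, this]
    abel
  refine tendsto_iff_norm_sub_tendsto_zero.2 (squeeze_zero (fun _ => norm_nonneg _)
    (g := fun n => (l n)⁻¹ * (M * ‖A ⟨z, hz⟩‖)) (fun n => ?_) ?_)
  · rw [e]
    have := hb n (A ⟨z, hz⟩)
    rw [norm_smul, Real.norm_of_nonneg (hl0 n).le] at this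
    exact (le_inv_mul_iff₀ (hl0 n)).2 this
  · simpa using (tendsto_inv_atTop_zero.comp hl).mul_const (M * ‖A ⟨z, hz⟩‖)

lemma tendsto_form {q : X →L[ℝ] X →L[ℝ] ℝ} {ι : Type*} {F : Filter ι} {u v : ι → X} {a b : X}
    (hu : Tendsto u F (𝓝 a)) (hv : Tendsto v F (𝓝 b)) :
    Tendsto (fun i => q (u i) (v i)) F (𝓝 (q a b)) :=
  (q.isBoundedBilinearMap.continuous.tendsto (a, b)).comp (hu.prodMk_nhds hv)

/-- The natural constant is the square root of `a = ‖q‖ / c`; since `a ≤ (1 + a)²`, the constant `1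
+ a` avoids the root. -/
lemma norm_le_of_form_le {q : X →L[ℝ] X →L[ℝ] ℝ} {c : ℝ} (hc : 0 < c) (hq : ∀ u, c * ‖u‖ * ‖u‖ ≤ q u u) (u v : X)
    (h : q u u ≤ q v v) : ‖u‖ ≤ (1 + ‖q‖ / c) * ‖v‖ := by
  have h1 := hq u
  have h2 : q v v ≤ ‖q‖ * ‖v‖ * ‖v‖ := (le_abs_self _).trans (q.le_opNorm₂ v v)
  have h3 : ‖u‖ * ‖u‖ ≤ ‖q‖ / c * (‖v‖ * ‖v‖) := by
    rw [div_mul_eq_mul_div, le_div_iff₀ hc]; linarith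
  have h4 : 0 ≤ ‖q‖ / c := by positivity
  refine abs_le_of_sq_le_sq' ?_ (by positivity) |>.2
  have h5 := mul_self_nonneg ‖v‖
  nlinarith [mul_nonneg h4 h5, mul_nonneg (mul_nonneg h4 h4) h5]

/-- The rescaled semigroup `e^{-ε t} T(t)`. -/
def rescale (T : C0Semigroup X) (ε : ℝ) :
    C0Semigroup X where
  toFun t := Real.exp (-ε * t) • T.toFun t
  map_zero := by simp [T.map_zero]
  map_add s t := by
    ext x
    simp only [T.map_add, NNReal.coe_add, mul_add, Real.exp_add, smul_apply,
      ContinuousLinearMap.comp_apply, map_smul, smul_smul]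
    rw [mul_comm]
  continuous_orbit x := by
    have h := T.continuous_orbit x
    have : Continuous fun t : ℝ≥0 => Real.exp (-ε * t) := by fun_prop
    exact this.smul h

lemma tendsto_rescale {T : C0Semigroup X}
    {x y : X} (ε : ℝ)
    (h : Tendsto (fun h : ℝ≥0 => (h : ℝ)⁻¹ • (T.toFun h x - x)) (𝓝[>] 0) (𝓝 y)) :
    Tendsto (fun h : ℝ≥0 => (h : ℝ)⁻¹ • ((rescale T ε).toFun h x - x)) (𝓝[>] 0)
      (𝓝 (y - ε • x)) := by
  have hexp : Tendsto (fun h : ℝ≥0 => Real.exp (-ε * h)) (𝓝[>] 0) (𝓝 1) := by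
    have : Continuous fun t : ℝ≥0 => Real.exp (-ε * t) := by fun_prop
    simpa using (this.tendsto 0).mono_left nhdsWithin_le_nhds
  have hslope : Tendsto (fun h : ℝ≥0 => (h : ℝ)⁻¹ * (Real.exp (-ε * h) - 1)) (𝓝[>] 0)
      (𝓝 (-ε)) := by
    have hd : HasDerivAt (fun s : ℝ => Real.exp (-ε * s)) (-ε) 0 := by
      simpa using ((hasDerivAt_id (0 : ℝ)).const_mul (-ε)).exp
    have h1 : Tendsto (fun s : ℝ≥0 => (s : ℝ)) (𝓝[>] 0) (𝓝[≠] (0 : ℝ)) := by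
      refine tendsto_nhdsWithin_iff.2
        ⟨(NNReal.continuous_coe.tendsto 0).mono_left nhdsWithin_le_nhds, ?_⟩
      filter_upwards [self_mem_nhdsWithin] with s hs
      exact (NNReal.coe_pos.2 hs).ne'
    have := hd.tendsto_slope_zero.comp h1
    simpa [Function.comp_def] using this
  have := (hexp.smul h).add (hslope.smul_const x)
  rw [one_smul, neg_smul, ← sub_eq_add_neg] at this
  refine this.congr fun s => ?_
  simp only [rescale, smul_apply]
  module

lemma rescale_rescale_neg (T : C0Semigroup X) (ε : ℝ) (t : ℝ≥0) :
    (rescale (rescale T ε) (-ε)).toFun t = T.toFun t := by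
  simp [rescale, smul_smul, ← Real.exp_add]

end NormedSpace

/-! ### Generation theorems on a Hilbert space. -/

variable {X : Type*} [NormedAddCommGroup X] [InnerProductSpace ℝ X] [CompleteSpace X]
  {q : X →L[ℝ] X →L[ℝ] ℝ}

/-- By Lax–Milgram, a vector orthogonal to the domain represents `q v` for some `v = x - A x`.
Testing with `x` gives `q(x, x) = q(A x, x) ≤ 0`, so `x = 0`. -/
lemma dense_domain (hq : IsCoercive q) {A : X →ₗ.[ℝ] X} (hA : ∀ x : A.domain, q (A x) x ≤ 0)
    (hsurj : ∀ f, ∃ x : A.domain, (x : X) - A x = f) : Dense (A.domain : Set X) := by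
  rw [Submodule.dense_iff_topologicalClosure_eq_top, Submodule.topologicalClosure_eq_top_iff,
    Submodule.eq_bot_iff]
  intro w hw
  obtain ⟨v, rfl⟩ := hq.continuousLinearEquivOfBilin.surjective w
  obtain ⟨x, rfl⟩ := hsurj v
  have h := (Submodule.mem_orthogonal' _ _).1 hw x x.2
  rw [hq.continuousLinearEquivOfBilin_apply, map_sub, sub_apply] at h
  obtain ⟨c, hc, hc'⟩ := hq
  have h1 := hc' (x : X)
  have h2 := hA x
  have h3 : ‖(x : X)‖ = 0 := by
    by_contra h0
    have : 0 < c * ‖(x : X)‖ * ‖(x : X)‖ := by positivity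
    linarith
  have h4 : x = 0 := Subtype.ext (norm_eq_zero.1 h3)
  simp [h4]

/-- The Lumer–Phillips theorem for an operator that is dissipative with respect to an equivalent
inner product `q`. -/
theorem exists_c0Semigroup_of_dissipative (hsymm : ∀ u v, q u v = q v u) (hq : IsCoercive q)
    {A : X →ₗ.[ℝ] X} (hA : ∀ x : A.domain, q (A x) x ≤ 0)
    (hsurj : ∀ l : ℝ, 0 < l → ∀ f, ∃ x : A.domain, l • (x : X) - A x = f) :
    ∃ T : C0Semigroup X, T.IsGeneratedBy A ∧ ∃ M, ∀ t, ‖T.toFun t‖ ≤ M := by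
  have hD := dense_domain hq hA fun f => by simpa using hsurj 1 one_pos f
  obtain ⟨c, hc, hqc⟩ := hq
  have hpos : ∀ u, 0 ≤ q u u := fun u => le_trans (by positivity) (hqc u)
  set M := 1 + ‖q‖ / c
  have hM0 : 0 ≤ M := by positivity
  have hM := norm_le_of_form_le hc hqc
  choose R hR hRb using fun n : ℕ => exists_isResolvent hsymm hpos hM hA
    (l := (n : ℝ) + 1) (by positivity) (hsurj _ (by positivity))
  have hform : ∀ (n : ℕ) u, q (yosida ((n : ℝ) + 1) (R n) u) u ≤ 0 := fun n =>
    form_yosida_nonpos hpos hA (by positivity) (hR n)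
  have hconv : ∀ x : A.domain,
      Tendsto (fun n : ℕ => yosida ((n : ℝ) + 1) (R n) x) atTop (𝓝 (A x)) := fun x => by
    simp only [fun n => (hR n).yosida_apply_domain x]
    exact tendsto_smul_resolvent hM0 hD (fun n => by positivity)
      (tendsto_atTop_add_const_right _ _ tendsto_natCast_atTop_atTop) hR hRb (A x)
  obtain ⟨T, hT, hgen⟩ := exists_c0Semigroup_of_exp hM0
    (fun m n => (hR m).commute_yosida (hR n))
    (fun n t ht x => hM _ _ (form_exp_smul_apply_le hsymm (hform n) ht x)) hD
    fun x hx => (hconv ⟨x, hx⟩).cauchySeq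
  have hTq : ∀ t x, q (T.toFun t x) (T.toFun t x) ≤ q x x := fun t x =>
    le_of_tendsto (tendsto_form (hT t x) (hT t x))
      (Eventually.of_forall fun n => form_exp_smul_apply_le hsymm (hform n) t.2 x)
  refine ⟨T, fun x y => ⟨fun hxy => ?_, fun hxy => ?_⟩, M, fun t =>
    ContinuousLinearMap.opNorm_le_bound _ hM0 fun x => hM _ _ (hTq t x)⟩
  · obtain ⟨z, rfl, rfl⟩ := (LinearPMap.mem_graph_iff A).1 hxy
    exact hgen _ _ (hconv z)
  -- The difference quotients of `x - z` converge to `y - A z = x - z`. Contractivity of `T` makes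
  -- their pairing with `x - z` nonpositive, which forces `x = z`.
  · obtain ⟨z, hz⟩ := hsurj 1 one_pos (x - y)
    rw [one_smul] at hz
    have hw := hxy.sub (hgen _ _ (hconv z))
    have hyz : y - A z = x - z := by
      rw [sub_eq_iff_eq_add] at hz ⊢; rw [hz]; abel
    rw [hyz] at hw
    have hlim := tendsto_form (q := q) hw (tendsto_const_nhds (x := x - (z : X)))
    have hle : q (x - z) (x - z) ≤ 0 := by
      refine le_of_tendsto hlim (Eventually.of_forall fun h => ?_)
      have e : (h : ℝ)⁻¹ • (T.toFun h x - x) - (h : ℝ)⁻¹ • (T.toFun h z - z)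
          = (h : ℝ)⁻¹ • (T.toFun h (x - z) - (x - z)) := by
        rw [← smul_sub, map_sub]; congr 1; abel
      simp only [e]
      rw [map_smul, smul_apply, smul_eq_mul, map_sub q, sub_apply]
      refine mul_nonpos_of_nonneg_of_nonpos (by positivity) ?_
      have h1 := form_le_half hsymm hpos (T.toFun h (x - z)) (x - z)
      have h2 := hTq h (x - z)
      linarith
    have hxz : x - (z : X) = 0 := by
      by_contra h0
      have := hqc (x - z)
      have h1 : 0 < ‖x - (z : X)‖ := norm_pos_iff.2 h0
      have : 0 < c * ‖x - (z : X)‖ * ‖x - (z : X)‖ := by positivity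
      linarith
    refine (LinearPMap.mem_graph_iff A).2 ⟨z, (sub_eq_zero.1 hxz).symm, ?_⟩
    exact (sub_eq_zero.1 (hyz.trans hxz)).symm

/-- An operator that is strictly dissipative with respect to an equivalent inner product `q`
generates an exponentially stable semigroup. -/
theorem exists_exponentiallyStable_of_dissipative (hsymm : ∀ u v, q u v = q v u)
    (hq : IsCoercive q) {A : X →ₗ.[ℝ] X} {ε : ℝ} (hε : 0 < ε)
    (hA : ∀ x : A.domain, q (A x) x ≤ -ε * q x x)
    (hsurj : ∀ l : ℝ, -ε < l → ∀ f, ∃ x : A.domain, l • (x : X) - A x = f) :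
    ∃ T : C0Semigroup X, T.IsGeneratedBy A ∧ T.IsExponentiallyStable := by
  -- Shifting by `ε` leaves `A'` dissipative, and `l - A' = (l - ε) - A`; hence the range condition
  -- for all `l > -ε`.
  let A' : X →ₗ.[ℝ] X := ⟨A.domain, A.toFun + ε • A.domain.subtype⟩
  have hA' : ∀ x : A.domain, A' x = A x + ε • (x : X) := fun x => rfl
  obtain ⟨T, hT, M, hM⟩ := exists_c0Semigroup_of_dissipative (A := A') hsymm hq
    (fun x => by
      have := hA x
      rw [hA' x, map_add, map_smul, add_apply, smul_apply, smul_eq_mul]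
      linarith)
    (fun l hl f => by
      obtain ⟨x, hx⟩ := hsurj (l - ε) (by linarith) f
      refine ⟨x, ?_⟩
      rw [hA' x, ← hx, sub_smul]
      abel)
  refine ⟨rescale T ε, fun x y => ?_, M, ε, hε, fun t => ?_⟩
  · have hgraph : (x, y) ∈ A.graph ↔ (x, y + ε • x) ∈ A'.graph := by
      rw [LinearPMap.mem_graph_iff, LinearPMap.mem_graph_iff]
      refine ⟨fun ⟨z, h1, h2⟩ => ⟨z, h1, ?_⟩, fun ⟨z, h1, h2⟩ => ⟨z, h1, ?_⟩⟩
      · simp only at h1 h2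
        rw [hA' z, h1, h2]
      · simp only at h1
        rw [hA' z, h1] at h2
        exact add_right_cancel h2
    rw [hgraph, hT x (y + ε • x)]
    refine ⟨fun h => by simpa using tendsto_rescale ε h, fun h => ?_⟩
    have := tendsto_rescale (-ε) h
    simpa only [rescale_rescale_neg, neg_smul, sub_neg_eq_add] using this
  · change ‖Real.exp (-ε * t) • T.toFun t‖ ≤ _
    rw [norm_smul, Real.norm_of_nonneg (Real.exp_nonneg _), mul_comm]
    exact mul_le_mul_of_nonneg_right (hM t) (Real.exp_nonneg _)

end LumerPhillips

namespace TireFriction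

/-! ### The weighted inner product -/

lemma continuous_act : Continuous (act : M2 → R2 →L[ℝ] R2) :=
  LinearMap.continuous_of_finiteDimensional
    (Matrix.toEuclideanCLM (n := Fin 2) (𝕜 := ℝ)).toAlgEquiv.toLinearMap

/-- A coefficient continuous on `[0, 1]` is essentially bounded, so the Hölder pairing of `L^∞` with
`L²` applies. -/
lemma exists_multiplication {K : ℝ → M2} (hK : ContinuousOn K (Icc 0 1)) :
    ∃ m : L2 →L[ℝ] L2, ∀ ζ, m ζ =ᵐ[vol01] fun ξ => act (K ξ) (ζ ξ) := by
  have hKa : ContinuousOn (fun ξ => act (K ξ)) (Icc 0 1) := continuous_act.comp_continuousOn hK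
  obtain ⟨C, hC⟩ := isCompact_Icc.exists_bound_of_continuousOn hKa
  have hm : AEStronglyMeasurable (fun ξ => act (K ξ)) vol01 :=
    (hKa.mono Ioo_subset_Icc_self).aestronglyMeasurable measurableSet_Ioo
  have hmem : MemLp (fun ξ => act (K ξ)) ∞ vol01 := by
    refine memLp_top_of_bound hm C ?_
    filter_upwards [ae_restrict_mem measurableSet_Ioo] with ξ hξ
    exact hC ξ (Ioo_subset_Icc_self hξ)
  refine ⟨(ContinuousLinearMap.id ℝ (R2 →L[ℝ] R2)).holderL vol01 ∞ 2 2 (hmem.toLp _),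
    fun ζ => ?_⟩
  filter_upwards [(ContinuousLinearMap.id ℝ (R2 →L[ℝ] R2)).coeFn_holder (r := 2)
    (hmem.toLp _) ζ, hmem.coeFn_toLp] with ξ h1 h2
  change (ContinuousLinearMap.id ℝ (R2 →L[ℝ] R2)).holder 2 (hmem.toLp _) ζ ξ = _
  rw [h1, h2]
  rfl

lemma inner_act_comm {A : M2} (hA : A.IsHermitian) (v w : R2) :
    inner ℝ v (act A w) = inner ℝ w (act A v) := by
  rw [Matrix.inner_toEuclideanCLM, Matrix.inner_toEuclideanCLM, Matrix.dotProduct_mulVec,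
    ← Matrix.mulVec_transpose, dotProduct_comm]
  congr 2

lemma inner_act_pos {A : M2} (hA : A.PosDef) {v : R2} (hv : v ≠ 0) : 0 < inner ℝ v (act A v) := by
  rw [Matrix.inner_toEuclideanCLM]
  simpa using hA.dotProduct_mulVec_pos (x := v.ofLp) (by simpa using hv)

namespace Model

variable (P : Model)

lemma Q_cont : ContinuousOn P.Q (Icc 0 1) :=
  P.K₁_cont.mul continuousOn_const

lemma exists_form : ∃ q : L2 →L[ℝ] L2 →L[ℝ] ℝ, ∀ f ζ, q f ζ = P.pairQ f ζ := by
  obtain ⟨m, hm⟩ := exists_multiplication P.Q_cont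
  refine ⟨((innerSL ℝ).flip.comp m).flip, fun f ζ => ?_⟩
  change inner ℝ f (m ζ) = _
  rw [MeasureTheory.L2.inner_def]
  refine integral_congr_ae ?_
  filter_upwards [hm ζ] with ξ hξ
  rw [hξ]

lemma pairQ_comm (f ζ : L2) : P.pairQ f ζ = P.pairQ ζ f := by
  refine setIntegral_congr_fun measurableSet_Ioo fun ξ hξ => ?_
  exact inner_act_comm (P.Q_posDef ξ (Ioo_subset_Icc_self hξ)).1 _ _

/-- The quadratic form attains a positive minimum on the compact set `[0, 1] × S¹`; homogeneity
extends the bound to all `v`. -/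
lemma exists_Q_lower_bound :
    ∃ c, 0 < c ∧ ∀ ξ ∈ Icc (0 : ℝ) 1, ∀ v : R2, c * ‖v‖ ^ 2 ≤ inner ℝ v (act (P.Q ξ) v) := by
  have hcont : ContinuousOn (fun p : ℝ × R2 => inner ℝ p.2 (act (P.Q p.1) p.2))
      (Icc 0 1 ×ˢ Metric.sphere 0 1) := by
    have h1 : ContinuousOn (fun p : ℝ × R2 => act (P.Q p.1)) (Icc 0 1 ×ˢ Metric.sphere 0 1) :=
      continuous_act.comp_continuousOn (P.Q_cont.comp continuousOn_fst fun p hp => hp.1)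
    exact continuousOn_snd.inner (h1.clm_apply continuousOn_snd)
  have hne : (Icc (0 : ℝ) 1 ×ˢ Metric.sphere (0 : R2) 1).Nonempty :=
    ⟨(0, EuclideanSpace.single 0 1), by simp⟩
  obtain ⟨p, hp, hmin⟩ := (isCompact_Icc.prod (isCompact_sphere (0 : R2) 1)).exists_isMinOn
    hne hcont
  have hp2 : p.2 ≠ 0 := fun h => by simpa [h] using hp.2
  refine ⟨_, inner_act_pos (P.Q_posDef p.1 hp.1) hp2, fun ξ hξ v => ?_⟩
  rcases eq_or_ne v 0 with rfl | hv
  · simp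
  have hv' : ‖v‖ ≠ 0 := norm_ne_zero_iff.2 hv
  have h := hmin (show (ξ, ‖v‖⁻¹ • v) ∈ _ from ⟨hξ, by simp [norm_smul, hv']⟩)
  simp only [mem_ofPred_eq, map_smul, inner_smul_left, inner_smul_right, RCLike.conj_to_real] at h
  calc _ ≤ ‖v‖⁻¹ * (‖v‖⁻¹ * inner ℝ v (act (P.Q ξ) v)) * ‖v‖ ^ 2 :=
        mul_le_mul_of_nonneg_right h (by positivity)
    _ = _ := by field_simp

lemma exists_pairQ_lower_bound : ∃ c, 0 < c ∧ ∀ ζ : L2, c * ‖ζ‖ * ‖ζ‖ ≤ P.pairQ ζ ζ := by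
  obtain ⟨c, hc, h⟩ := P.exists_Q_lower_bound
  refine ⟨c, hc, fun ζ => ?_⟩
  obtain ⟨m, hm⟩ := exists_multiplication P.Q_cont
  have hint : Integrable (fun ξ => inner ℝ (ζ ξ) (act (P.Q ξ) (ζ ξ))) vol01 := by
    refine (MeasureTheory.L2.integrable_inner (𝕜 := ℝ) ζ (m ζ)).congr ?_
    filter_upwards [hm ζ] with ξ hξ
    rw [hξ]
  rw [mul_assoc, ← real_inner_self_eq_norm_mul_norm, MeasureTheory.L2.inner_def,
    ← integral_const_mul]
  refine integral_mono_ae ((MeasureTheory.L2.integrable_inner (𝕜 := ℝ) ζ ζ).const_mul c) hint ?_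
  filter_upwards [ae_restrict_mem measurableSet_Ioo] with ξ hξ
  rw [real_inner_self_eq_norm_sq]
  exact h ξ (Ioo_subset_Icc_self hξ) _

end Model
end TireFriction

namespace TireFriction

/-! ### A linear transport equation with boundary value zero -/

/-- Integration by parts against the primitive of an integrable function. -/
lemma integral_deriv_apply_primitive {ψ F : ℝ → R2 →L[ℝ] R2} (hF : Continuous F)
    (hψ : ∀ ξ, HasDerivAt ψ (F ξ) ξ) (h1 : ψ 1 = 0) {h : ℝ → R2} (hh : Integrable h vol01) :
    ∫ ξ in Ioo (0 : ℝ) 1, F ξ (∫ s in Ioo (0 : ℝ) 1, (Iio ξ).indicator h s)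
      = -∫ s in Ioo (0 : ℝ) 1, ψ s (h s) := by
  have hset : MeasurableSet {p : ℝ × ℝ | p.2 < p.1} := measurableSet_lt measurable_snd measurable_fst
  have hswap : Integrable (Function.uncurry fun ξ s => F ξ ((Iio ξ).indicator h s))
      (vol01.prod vol01) := by
    have e : (Function.uncurry fun ξ s => F ξ ((Iio ξ).indicator h s))
        = {p : ℝ × ℝ | p.2 < p.1}.indicator fun p => F p.1 (h p.2) := by
      ext1 ⟨ξ, s⟩
      by_cases hs : s < ξ <;> simp [Function.uncurry, indicator, hs]
    rw [e]
    refine Integrable.indicator ?_ hset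
    obtain ⟨C, hC⟩ := isCompact_Icc.exists_bound_of_continuousOn (s := Icc (0 : ℝ) 1)
      hF.continuousOn
    refine ((hh.comp_snd vol01).norm.const_mul C).mono'
      ((ContinuousLinearMap.id ℝ (R2 →L[ℝ] R2)).aestronglyMeasurable_comp₂
        (hF.comp continuous_fst).aestronglyMeasurable (hh.comp_snd vol01).1) ?_
    have : ∀ᵐ p ∂(vol01.prod vol01), p.1 ∈ Ioo (0 : ℝ) 1 :=
      Measure.quasiMeasurePreserving_fst.ae (ae_restrict_mem measurableSet_Ioo)
    filter_upwards [this] with p hp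
    exact (F p.1).le_of_opNorm_le (hC _ (Ioo_subset_Icc_self hp)) _
  have e1 : ∀ ξ, F ξ (∫ s in Ioo (0 : ℝ) 1, (Iio ξ).indicator h s)
      = ∫ s in Ioo (0 : ℝ) 1, F ξ ((Iio ξ).indicator h s) := fun ξ =>
    ((F ξ).integral_comp_comm (hh.indicator measurableSet_Iio)).symm
  simp only [e1]
  -- Fubini on the triangle `s < ξ`: the inner integral of `F` over `(s, 1)` is `ψ 1 - ψ s = -ψ s`.
  rw [integral_integral_swap hswap, ← integral_neg]
  refine setIntegral_congr_fun measurableSet_Ioo fun s hs => ?_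
  have e2 : ∀ ξ, F ξ ((Iio ξ).indicator h s) = (Ioi s).indicator (fun ξ => F ξ (h s)) ξ := by
    intro ξ
    by_cases h : s < ξ <;> simp [indicator, h]
  have e3 : Ioo (0 : ℝ) 1 ∩ Ioi s = Ioo s 1 := by
    ext ξ
    simp only [mem_inter_iff, mem_Ioo, mem_Ioi]
    exact ⟨fun h => ⟨h.2, h.1.2⟩, fun h => ⟨⟨hs.1.trans h.1, h.2⟩, h.1⟩⟩
  simp only [e2]
  rw [setIntegral_indicator measurableSet_Ioi, e3, ← integral_Ioc_eq_integral_Ioo,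
    ← intervalIntegral.integral_of_le hs.2.le,
    intervalIntegral.integral_eq_sub_of_hasDerivAt (f := fun ξ => ψ ξ (h s))
      (fun ξ _ => ((hψ ξ).clm_apply (hasDerivAt_const ξ (h s))).congr_deriv (by simp))
      ((hF.clm_apply continuous_const).intervalIntegrable _ _), h1]
  simp

lemma exists_primitive {h : ℝ → R2} (hh : Integrable h vol01) :
    ∃ u : ℝ → R2, Continuous u ∧ u 0 = 0 ∧
      ∀ ξ ∈ Ioo (0 : ℝ) 1, u ξ = ∫ s in Ioo (0 : ℝ) 1, (Iio ξ).indicator h s := by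
  -- Integrating against `vol01` makes the primitive continuous on all of `ℝ`, although `h` is
  -- controlled only on `(0, 1)`.
  refine ⟨fun ξ => ∫ s in (0 : ℝ)..ξ, h s ∂vol01, hh.continuous_primitive 0, by simp,
    fun ξ hξ => ?_⟩
  simp only
  rw [intervalIntegral.integral_of_le hξ.1.le, Measure.restrict_restrict measurableSet_Ioc,
    setIntegral_indicator measurableSet_Iio]
  refine setIntegral_congr_set ?_
  have e1 : Ioc (0 : ℝ) ξ ∩ Ioo 0 1 = Ioc 0 ξ := inter_eq_left.2 fun s hs =>
    ⟨hs.1, hs.2.trans_lt hξ.2⟩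
  have e2 : Ioo (0 : ℝ) 1 ∩ Iio ξ = Ioo 0 ξ := by
    ext s
    simp only [mem_inter_iff, mem_Ioo, mem_Iio]
    exact ⟨fun h => ⟨h.1.1, h.2⟩, fun h => ⟨⟨h.1, h.2.trans hξ.2⟩, h.2⟩⟩
  rw [e1, e2]
  exact Ioo_ae_eq_Ioc.symm

lemma exists_isContRep {w : ℝ → R2} (hw : Continuous w) : ∃ ζ : L2, IsContRep ζ w := by
  obtain ⟨C, hC⟩ := isCompact_Icc.exists_bound_of_continuousOn (s := Icc (0 : ℝ) 1)
    hw.continuousOn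
  have hmem : MemLp w 2 vol01 := by
    refine MemLp.of_bound hw.aestronglyMeasurable C ?_
    filter_upwards [ae_restrict_mem measurableSet_Ioo] with ξ hξ
    exact hC ξ (Ioo_subset_Icc_self hξ)
  exact ⟨hmem.toLp w, hw.continuousOn, hmem.coeFn_toLp⟩

lemma weakDeriv_eq {ζ : H1} {g : L2} (h : IsWeakDeriv ζ g) : weakDeriv ζ = g :=
  IsWeakDeriv.unique ζ.2.choose_spec h

lemma exp_smul_apply_exp_neg_smul {X : Type*} [NormedAddCommGroup X] [NormedSpace ℝ X]
    [CompleteSpace X] (B : X →L[ℝ] X) (t : ℝ) (x : X) :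
    NormedSpace.exp (t • B) (NormedSpace.exp ((-t) • B) x) = x := by
  let _ : NormedAlgebra ℚ (X →L[ℝ] X) := NormedAlgebra.restrictScalars ℚ ℝ _
  have : NormedSpace.exp (t • B) * NormedSpace.exp ((-t) • B) = 1 := by
    have hc : Commute (t • B) ((-t) • B) := ((Commute.refl B).smul_left _).smul_right _
    rw [← NormedSpace.exp_add_of_commute hc, ← add_smul, add_neg_cancel, zero_smul,
      NormedSpace.exp_zero]
  exact DFunLike.congr_fun this x

/-- Variation of constants for `ζ' = N ζ + g`, `ζ(0) = 0`. -/
theorem exists_weakDeriv_eq (N : R2 →L[ℝ] R2) (g : L2) :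
    ∃ ζ : dom, weakDeriv (Submodule.inclusion dom_le_H1 ζ) = N.compLpL 2 vol01 ζ + g := by
  -- The solution is `ζ(ξ) = E(ξ) ∫₀^ξ E(-s) g(s) ds`.
  let E : ℝ → R2 →L[ℝ] R2 := fun ξ => NormedSpace.exp (ξ • N)
  have hE : ∀ ξ, HasDerivAt E (N * E ξ) ξ := fun ξ => hasDerivAt_exp_smul_const' (𝕂 := ℝ) N ξ
  have hEc : Continuous E := continuous_iff_continuousAt.2 fun ξ => (hE ξ).continuousAt
  have hEinv : ∀ ξ v, E ξ (E (-ξ) v) = v := exp_smul_apply_exp_neg_smul N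
  have hh : Integrable (fun s => E (-s) (g s)) vol01 := by
    have hc : Continuous fun s => E (-s) := hEc.comp continuous_neg
    obtain ⟨C, hC⟩ := isCompact_Icc.exists_bound_of_continuousOn (s := Icc (0 : ℝ) 1)
      hc.continuousOn
    refine ((integrable_L2 g).norm.const_mul C).mono'
      ((ContinuousLinearMap.id ℝ (R2 →L[ℝ] R2)).aestronglyMeasurable_comp₂
        hc.aestronglyMeasurable (Lp.aestronglyMeasurable g)) ?_
    filter_upwards [ae_restrict_mem measurableSet_Ioo] with ξ hξ
    exact (E (-ξ)).le_of_opNorm_le (hC ξ (Ioo_subset_Icc_self hξ)) _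
  obtain ⟨u, hu, hu0, hui⟩ := exists_primitive hh
  have hw : Continuous fun ξ => E ξ (u ξ) := hEc.clm_apply hu
  obtain ⟨ζ, hζ⟩ := exists_isContRep hw
  have key : IsWeakDeriv ζ (N.compLpL 2 vol01 ζ + g) := by
    intro φ hφ hc hs
    have hφ' : Continuous (deriv φ) := hφ.continuous_deriv (by simp)
    have hd : ∀ ξ, HasDerivAt φ (deriv φ ξ) ξ := fun ξ =>
      (hφ.differentiable (by simp) ξ).hasDerivAt
    have hφ1 : φ 1 = 0 := image_eq_zero_of_notMem_tsupport fun h => by simpa using hs h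
    -- Taking `ψ = φ E` yields `φ N ζ + φ' ζ` on the left, and `E(s) E(-s) = 1` leaves `φ g` on the
    -- right.
    have ibp := integral_deriv_apply_primitive (ψ := fun ξ => φ ξ • E ξ)
      (F := fun ξ => φ ξ • (N * E ξ) + deriv φ ξ • E ξ)
      ((hφ.continuous.smul (continuous_const.mul hEc)).add (hφ'.smul hEc))
      (fun ξ => (hd ξ).smul (hE ξ)) (by ext1 v; simp [hφ1]) hh
    have l1 : ∫ ξ in Ioo (0 : ℝ) 1, (φ ξ • (N * E ξ) + deriv φ ξ • E ξ)
          (∫ s in Ioo (0 : ℝ) 1, (Iio ξ).indicator (fun s => E (-s) (g s)) s)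
        = ∫ ξ in Ioo (0 : ℝ) 1, (φ ξ • (N.compLpL 2 vol01 ζ) ξ + deriv φ ξ • ζ ξ) := by
      refine integral_congr_ae ?_
      filter_upwards [ae_restrict_mem measurableSet_Ioo, hζ.2, N.coeFn_compLpL (p := 2) ζ]
        with ξ hξ h1 h2
      rw [← hui ξ hξ, h2, h1]
      rfl
    have l2 : ∀ s, (φ s • E s) (E (-s) (g s)) = φ s • g s := fun s => by
      rw [smul_apply, hEinv]
    rw [l1, integral_add (integrable_smul_of_continuous hφ.continuous hc _)
      (integrable_smul_of_continuous hφ' hc.deriv _)] at ibp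
    simp only [l2] at ibp
    have l3 : ∫ ξ in Ioo (0 : ℝ) 1, φ ξ • (N.compLpL 2 vol01 ζ + g : L2) ξ
        = (∫ ξ in Ioo (0 : ℝ) 1, φ ξ • (N.compLpL 2 vol01 ζ) ξ)
          + ∫ ξ in Ioo (0 : ℝ) 1, φ ξ • g ξ := by
      rw [← integral_add (integrable_smul_of_continuous hφ.continuous hc _)
        (integrable_smul_of_continuous hφ.continuous hc _)]
      refine integral_congr_ae ?_
      filter_upwards [Lp.coeFn_add (N.compLpL 2 vol01 ζ) g] with ξ hξ
      rw [hξ, Pi.add_apply, smul_add]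
    rw [l3, neg_add, ← ibp]
    abel
  exact ⟨⟨ζ, ⟨_, key⟩, _, hζ, by simp [hu0]⟩, weakDeriv_eq key⟩

end TireFriction

/-- A surjective linear map plus an injectivity-preserving perturbation that factors through a
finite-dimensional space is surjective. -/
lemma LinearMap.surjective_sub_comp_of_injective {V D Y : Type*} [AddCommGroup V] [Module ℝ V]
    [FiniteDimensional ℝ V] [AddCommGroup D] [Module ℝ D] [AddCommGroup Y] [Module ℝ Y]
    {Φ : D →ₗ[ℝ] Y} (hΦ : Function.Surjective Φ) (k : V →ₗ[ℝ] Y) (F : D →ₗ[ℝ] V)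
    (hinj : ∀ x, Φ x - k (F x) = 0 → x = 0) (f : Y) : ∃ x, Φ x - k (F x) = f := by
  obtain ⟨s, hs⟩ := Φ.exists_rightInverse_of_surjective (LinearMap.range_eq_top.2 hΦ)
  have hs' : ∀ y, Φ (s y) = y := fun y => LinearMap.congr_fun hs y
  -- The ansatz `x = s (f + k c)` turns the equation into `G c = F (s f)` on `V`, where injectivity
  -- implies surjectivity.
  let G : V →ₗ[ℝ] V := LinearMap.id - F ∘ₗ s ∘ₗ k
  have hG : Function.Injective G := (injective_iff_map_eq_zero G).2 fun c hc => by
    have h1 : c = F (s (k c)) := sub_eq_zero.1 hc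
    have h2 : s (k c) = 0 := hinj _ (by rw [hs', ← h1, sub_self])
    rw [h1, h2, map_zero]
  obtain ⟨c, hc⟩ := LinearMap.injective_iff_surjective.1 hG (F (s f))
  have hc' : c - F (s (k c)) = F (s f) := hc
  refine ⟨s (f + k c), ?_⟩
  have : F (s (f + k c)) = c := by rw [map_add, map_add, ← hc']; abel
  rw [hs', this, add_sub_cancel_right]

namespace TireFriction

lemma mulL2_constL2 (M : M2) (v : R2) : mulL2 M (constL2 v) = constL2 (act M v) := by
  refine Lp.ext ?_
  filter_upwards [(act M).coeFn_compLpL (p := 2) (μ := vol01) (constL2 v),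
    Lp.coeFn_const (p := 2) (μ := vol01) v, Lp.coeFn_const (p := 2) (μ := vol01) (act M v)]
    with ξ h1 h2 h3
  rw [h1]
  change act M (Lp.const 2 vol01 v ξ) = Lp.const 2 vol01 (act M v) ξ
  rw [h2, h3]
  rfl

lemma mulL2_compLpL (M : M2) (N : R2 →L[ℝ] R2) (ζ : L2) :
    mulL2 M (N.compLpL 2 vol01 ζ) = ((act M).comp N).compLpL 2 vol01 ζ := by
  refine Lp.ext ?_
  filter_upwards [(act M).coeFn_compLpL (p := 2) (μ := vol01) (N.compLpL 2 vol01 ζ),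
    N.coeFn_compLpL (p := 2) (μ := vol01) ζ,
    ((act M).comp N).coeFn_compLpL (p := 2) (μ := vol01) ζ] with ξ h1 h2 h3
  rw [h1, h2, h3]
  rfl

lemma compLpL_smul_sub_smul_id (M : M2) (a b : ℝ) (ζ : L2) :
    (a • act M - b • ContinuousLinearMap.id ℝ R2).compLpL 2 vol01 ζ
      = a • mulL2 M ζ - b • ζ := by
  refine Lp.ext ?_
  filter_upwards [(a • act M - b • ContinuousLinearMap.id ℝ R2).coeFn_compLpL (p := 2)
      (μ := vol01) ζ, (act M).coeFn_compLpL (p := 2) (μ := vol01) ζ,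
    Lp.coeFn_sub (a • mulL2 M ζ) (b • ζ), Lp.coeFn_smul a (mulL2 M ζ), Lp.coeFn_smul b ζ]
    with ξ h1 h2 h3 h4 h5
  rw [h1, h3, Pi.sub_apply, h4, h5, Pi.smul_apply, Pi.smul_apply, h2]
  rfl

lemma act_comp_act_inv {M : M2} (hM : IsUnit M) :
    (act M).comp (act M⁻¹) = ContinuousLinearMap.id ℝ R2 := by
  have h : M * M⁻¹ = 1 := Matrix.mul_nonsing_inv M ((Matrix.isUnit_iff_isUnit_det M).1 hM)
  calc _ = act (M * M⁻¹) := (map_mul _ M M⁻¹).symm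
    _ = _ := by rw [h]; exact map_one _

lemma mulL2_surjective {M : M2} (hM : IsUnit M) : Function.Surjective (mulL2 M) := fun f => by
  refine ⟨(act M⁻¹).compLpL 2 vol01 f, ?_⟩
  rw [mulL2_compLpL, act_comp_act_inv hM]
  refine Lp.ext ?_
  filter_upwards [(ContinuousLinearMap.id ℝ R2).coeFn_compLpL (p := 2) (μ := vol01) f] with ξ h
  rw [h]
  rfl

namespace Model

variable (P : Model)

lemma opASig_apply (y : R2) (ζ : dom) :
    P.opASig y ζ = P.θ • P.source y ζ + P.opA ζ := rfl

lemma source_apply (y : R2) (ζ : L2) :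
    P.source y ζ = mulL2 (P.Sig y) (ζ + constL2 (P.opK₂ ζ)) := rfl

lemma opA_apply (ζ : dom) :
    P.opA ζ = -mulL2 P.Lam (weakDeriv (Submodule.inclusion dom_le_H1 ζ))
      + constL2 (P.opK₃ ζ) := rfl

/-- Range condition: `l - 𝒜_Σ(y)` is onto as soon as it is one-to-one. -/
lemma exists_smul_sub_opASig_eq (y : R2) (l : ℝ)
    (hinj : ∀ ζ : dom, l • (ζ : L2) - P.opASig y ζ = 0 → ζ = 0) (f : L2) :
    ∃ ζ : dom, l • (ζ : L2) - P.opASig y ζ = f := by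
  have hΛ : IsUnit P.Lam := P.Lam_posDef.isUnit
  -- The local part of `l - 𝒜_Σ(y)` is `Λ (∂ - N)` with `N = Λ⁻¹ (θ Σ(y) - l)`.
  let B : R2 →L[ℝ] R2 := P.θ • act (P.Sig y) - l • ContinuousLinearMap.id ℝ R2
  let N : R2 →L[ℝ] R2 := (act P.Lam⁻¹).comp B
  let Φ : dom →ₗ[ℝ] L2 := (mulL2 P.Lam).toLinearMap ∘ₗ
    (weakDeriv ∘ₗ Submodule.inclusion dom_le_H1
      - (N.compLpL 2 vol01).toLinearMap ∘ₗ dom.subtype)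
  -- All nonlocal terms are constant functions. Only linearity of `F` matters, so the trace `ζ(1)`
  -- need not be bounded on `L2`.
  let F : dom →ₗ[ℝ] R2 :=
    P.θ • ((act (P.Sig y)).toLinearMap ∘ₗ P.opK₂ ∘ₗ dom.subtype) + P.opK₃
  have hΦ : Function.Surjective Φ := by
    refine (mulL2_surjective hΛ).comp fun g => ?_
    obtain ⟨ζ, hζ⟩ := exists_weakDeriv_eq N g
    exact ⟨ζ, sub_eq_iff_eq_add'.2 hζ⟩
  have hN : ∀ ζ : L2, mulL2 P.Lam (N.compLpL 2 vol01 ζ)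
      = P.θ • mulL2 (P.Sig y) ζ - l • ζ := fun ζ => by
    rw [mulL2_compLpL, ← ContinuousLinearMap.comp_assoc, act_comp_act_inv hΛ,
      ContinuousLinearMap.id_comp, compLpL_smul_sub_smul_id]
  have hfac : ∀ ζ : dom, Φ ζ - constL2 (F ζ) = l • (ζ : L2) - P.opASig y ζ := fun ζ => by
    have e1 : Φ ζ = mulL2 P.Lam (weakDeriv (Submodule.inclusion dom_le_H1 ζ))
        - mulL2 P.Lam (N.compLpL 2 vol01 (ζ : L2)) := map_sub (mulL2 P.Lam) _ _
    have e2 : F ζ = P.θ • act (P.Sig y) (P.opK₂ ζ) + P.opK₃ ζ := rfl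
    rw [e1, e2, hN, opASig_apply, source_apply, opA_apply, map_add, map_add, mulL2_constL2,
      map_smul]
    module
  obtain ⟨ζ, hζ⟩ := LinearMap.surjective_sub_comp_of_injective hΦ constL2.toLinearMap F
    (fun ζ h => hinj ζ ((hfac ζ).symm.trans h)) f
  exact ⟨ζ, (hfac ζ).symm.trans hζ⟩

lemma pairQ_source_nonpos (hSig : P.SourceDissipativeLipschitz) (y : R2) (ζ : L2) :
    P.pairQ (P.source y ζ) ζ ≤ 0 := by
  refine le_trans (le_of_eq ?_) (hSig.1 y ζ)
  -- Symmetry of `𝒬` puts the weight on the source term, as in assumption 2.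
  rw [pairQ_comm]
  refine integral_congr_ae ?_
  filter_upwards [(act (P.Sig y)).coeFn_compLpL (p := 2) (μ := vol01)
      (ζ + constL2 (P.opK₂ ζ)), Lp.coeFn_add ζ (constL2 (P.opK₂ ζ)),
    Lp.coeFn_const (p := 2) (μ := vol01) (P.opK₂ ζ)] with ξ h1 h2 h3
  have h3' : (constL2 (P.opK₂ ζ) : L2) ξ = P.opK₂ ζ := h3
  rw [source_apply, h1, h2, Pi.add_apply, h3']

lemma strictlyDissipative_opASig {ω : ℝ} (hA : P.StrictlyDissipative P.opA ω)
    (hSig : P.SourceDissipativeLipschitz) (y : R2) : P.StrictlyDissipative (P.opASig y) ω := by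
  intro ζ
  obtain ⟨q, hq⟩ := P.exists_form
  have h1 := hA ζ
  have h2 := mul_nonpos_of_nonneg_of_nonpos P.θ_nonneg (P.pairQ_source_nonpos hSig y ζ)
  rw [← hq] at h1 h2 ⊢
  have e : P.opASig y ζ = P.θ • P.source y (ζ : L2) + P.opA ζ := rfl
  rw [e, map_add, map_smul, add_apply, smul_apply, smul_eq_mul]
  linarith

theorem exists_c0Semigroup_of_strictlyDissipative {ω : ℝ} (hω : 0 < ω) {y : R2}
    (h : P.StrictlyDissipative (P.opASig y) ω) :
    ∃ T : C0Semigroup L2, T.IsGeneratedBy (P.opASig y) ∧ T.IsExponentiallyStable := by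
  obtain ⟨q, hq⟩ := P.exists_form
  obtain ⟨c, hc, hcoer⟩ := P.exists_pairQ_lower_bound
  have hsymm : ∀ u v, q u v = q v u := fun u v => by rw [hq, hq, pairQ_comm]
  -- Since `q(ζ, ζ) ≤ ‖q‖ ‖ζ‖²`, the rate `ω` for the norm becomes `ω / (‖q‖ + 1)` for `q`; the `+
  -- 1` excludes division by zero.
  have hε : 0 < ω / (‖q‖ + 1) := by positivity
  have hdiss : ∀ ζ : dom, q (P.opASig y ζ) ζ ≤ -(ω / (‖q‖ + 1)) * q (ζ : L2) ζ := fun ζ => by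
    have h1 := h ζ
    have h2 : q (ζ : L2) ζ ≤ ‖q‖ * ‖(ζ : L2)‖ * ‖(ζ : L2)‖ :=
      (le_abs_self _).trans (q.le_opNorm₂ _ _)
    have h3 : ω / (‖q‖ + 1) * q (ζ : L2) ζ ≤ ω * ‖(ζ : L2)‖ ^ 2 := by
      rw [div_mul_eq_mul_div, div_le_iff₀ (by positivity), mul_assoc]
      refine mul_le_mul_of_nonneg_left ?_ hω.le
      nlinarith [sq_nonneg ‖(ζ : L2)‖]
    rw [hq]
    linarith
  refine LumerPhillips.exists_exponentiallyStable_of_dissipative hsymm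
    ⟨c, hc, fun u => by rw [hq]; exact hcoer u⟩ hε hdiss fun l hl f =>
      P.exists_smul_sub_opASig_eq y l (fun ζ hζ => ?_) f
  -- Injectivity: `𝒜_Σ(y) ζ = l ζ` gives `l q(ζ, ζ) ≤ -ε q(ζ, ζ)` with `ε = ω / (‖q‖ + 1)`,
  -- impossible for `ζ ≠ 0` and `l > -ε`.
  have h1 := hdiss ζ
  rw [← sub_eq_zero.1 hζ, map_smul, smul_apply, smul_eq_mul, hq] at h1
  have h2 := hcoer (ζ : L2)
  by_contra h0
  have h3 : 0 < ‖(ζ : L2)‖ := norm_pos_iff.2 fun h => h0 (Subtype.ext h)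
  have h4 : 0 < P.pairQ (ζ : L2) ζ := lt_of_lt_of_le (by positivity) h2
  nlinarith

end Model
end TireFriction

theorem mainTheorem5 (P : TireFriction.Model) (ω : ℝ) (hω : 0 < ω)
    (hA : P.StrictlyDissipative P.opA ω) (hSig : P.SourceDissipativeLipschitz)
    (y : TireFriction.R2) :
    (∃ T : C0Semigroup TireFriction.L2,
        T.IsGeneratedBy (P.opASig y) ∧ T.IsExponentiallyStable) ∧
      P.StrictlyDissipative (P.opASig y) ω := by
  have h := P.strictlyDissipative_opASig hA hSig y
  exact ⟨P.exists_c0Semigroup_of_strictlyDissipative hω h, h⟩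

end
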